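/- Let $\mathfrak P$ be the ring of polytopes: the free abelian group on the set of nonempty convex polytopes up to combinatorial equivalence (isomorphism of face lattices), with multiplication induced by the product of polytopes. Let $d:\mathfrak P\to\mathfrak P$ be the additive map sending each polytope to the sum of its facets. For a connected simple graph $\Gamma$ on $[n]=\{1,\dots,n\}$, $n\ge 1$, the graph-associahedron is $$P_\Gamma=\Big\{x\in\mathbb R^n:\ \sum_{i=1}^n x_i=3^n,\quad \sum_{i\in S}x_i\ge 3^{|S|}\ \text{ for all nonempty } S\subsetneq[n] \text{ with } \Gamma|_S \text{ connected}\Big\}.$$ The associahedron $\mathfrak a_n$ and the permutohedron $\pi_n$ are the graph-associahedra of the path and of the complete graph on $n$ vertices. For a nonempty $S\subsetneq[n]$ with $\Gamma|_S$ connected, $\Gamma/S$ is the graph with vertex set $[n]\setminus S$ in which two distinct vertices $i,j$ are adjacent iff they are joined by a path in $\Gamma|_{S\cup\{i,j\}}$. **Theorem.** Let $\Gamma_n$, $n\ge 1$, be a sequence of connected simple graphs, $\Gamma_n$ having vertex set $[n]$, and let $P_k=P_{\Gamma_{k+1}}$, $k\ge 0$. 1. The subring of $\mathfrak P$ generated by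 all the $P_k$ is closed under $d$ if and only if either $P_k=\mathfrak a_{k+1}$ in $\mathfrak P$ for all $k\ge 0$, or $P_k=\pi_{k+1}$ in $\mathfrak P$ for all $k\ge 0$. Moreover, if this subring is closed under $d$, then either every $\Gamma_n$ is isomorphic to the path on $n$ vertices, or every $\Gamma_n$ is the complete graph on $n$ vertices. 2. (Graph lemma.) Suppose that for every $n$ and every nonempty proper subset $S\subsetneq[n]$ with $\Gamma_n|_S$ connected, each of the graphs $\Gamma_n|_S$ and $\Gamma_n/S$ is isomorphic to some $\Gamma_j$ with $j<n$. Then either every $\Gamma_n$ is isomorphic to the path on $n$ vertices, or every $\Gamma_n$ is the complete graph on $n$ vertices. -/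

import Mathlib

/-- The nonempty faces of a convex set `A` (including `A` itself), ordered by inclusion: the nonempty
convex subsets `F` of `A` such that a segment of `A` which has an interior point in `F` has its
endpoints in `F`. For a polytope, the usual face lattice is this poset with the empty face added as
bottom. -/
abbrev FaceOf {E : Type} [AddCommGroup E] [Module ℝ E] (A : Set E) : Type :=
  {F : Set E // F.Nonempty ∧ Convex ℝ F ∧ IsExtreme ℝ A F}

/-- The nonempty faces of a product are the products of nonempty faces. -/
def FaceOf.prodIso {E E' : Type} [AddCommGroup E] [Module ℝ E] [AddCommGroup E'] [Module ℝ E']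
    (A : Set E) (B : Set E') : FaceOf (A ×ˢ B) ≃o FaceOf A × FaceOf B where
  toFun F :=
    (⟨Prod.fst '' F.1, F.2.1.image _, F.2.2.1.is_linear_image (LinearMap.fst ℝ E E').isLinear, by
        refine ⟨?_, ?_⟩
        · rintro _ ⟨x, hx, rfl⟩
          exact (F.2.2.2.subset hx).1
        · rintro p hp q hq _ ⟨x, hx, rfl⟩ ⟨s, t, hs, ht, hst, hpq⟩
          have hxB := (F.2.2.2.subset hx).2
          exact ⟨(p, x.2), F.2.2.2.left_mem_of_mem_openSegment (y := (q, x.2)) ⟨hp, hxB⟩ ⟨hq, hxB⟩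
            hx ⟨s, t, hs, ht, hst, Prod.ext hpq (by simp [← add_smul, hst])⟩, rfl⟩⟩,
    ⟨Prod.snd '' F.1, F.2.1.image _, F.2.2.1.is_linear_image (LinearMap.snd ℝ E E').isLinear, by
        refine ⟨?_, ?_⟩
        · rintro _ ⟨x, hx, rfl⟩
          exact (F.2.2.2.subset hx).2
        · rintro p hp q hq _ ⟨x, hx, rfl⟩ ⟨s, t, hs, ht, hst, hpq⟩
          have hxA := (F.2.2.2.subset hx).1
          exact ⟨(x.1, p), F.2.2.2.left_mem_of_mem_openSegment (y := (x.1, q)) ⟨hxA, hp⟩ ⟨hxA, hq⟩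
            hx ⟨s, t, hs, ht, hst, Prod.ext (by simp [← add_smul, hst]) hpq⟩, rfl⟩⟩)
  invFun FG := ⟨FG.1.1 ×ˢ FG.2.1, FG.1.2.1.prod FG.2.2.1, FG.1.2.2.1.prod FG.2.2.2.1,
    fun _ hx => ⟨FG.1.2.2.2.subset hx.1, FG.2.2.2.2.subset hx.2⟩, by
      rintro x hx y hy _ hz ⟨s, t, hs, ht, hst, rfl⟩
      exact ⟨FG.1.2.2.2.left_mem_of_mem_openSegment hx.1 hy.1 hz.1 ⟨s, t, hs, ht, hst, rfl⟩,
        FG.2.2.2.2.left_mem_of_mem_openSegment hx.2 hy.2 hz.2 ⟨s, t, hs, ht, hst, rfl⟩⟩⟩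
  left_inv F := by
    apply Subtype.ext
    apply Set.Subset.antisymm
    · rintro ⟨u, v⟩ ⟨⟨x, hx, hxz⟩, ⟨y, hy, hyz⟩⟩
      simp only at hxz hyz
      subst hxz hyz
      have hxP := F.2.2.2.subset hx
      have hyP := F.2.2.2.subset hy
      have hm : (1 / 2 : ℝ) • x + (1 / 2 : ℝ) • y ∈ F.1 :=
        F.2.2.1 hx hy (by norm_num) (by norm_num) (by norm_num)
      exact F.2.2.2.left_mem_of_mem_openSegment (y := (y.1, x.2)) ⟨hxP.1, hyP.2⟩ ⟨hyP.1, hxP.2⟩ hm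
        ⟨1 / 2, 1 / 2, by norm_num, by norm_num, by norm_num,
          Prod.ext (by simp) (by simp [add_comm])⟩
    · exact fun x hx => ⟨⟨x, hx, rfl⟩, ⟨x, hx, rfl⟩⟩
  right_inv FG := Prod.ext (Subtype.ext (Set.fst_image_prod _ FG.2.2.1))
    (Subtype.ext (Set.snd_image_prod FG.1.2.1 _))
  map_rel_iff' := by
    intro F G
    constructor
    · rintro ⟨h1, h2⟩ ⟨u, v⟩ hz
      obtain ⟨x, hx, hxz⟩ := h1 ⟨_, hz, rfl⟩
      obtain ⟨y, hy, hyz⟩ := h2 ⟨_, hz, rfl⟩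
      simp only at hxz hyz
      subst hxz hyz
      have hxP := G.2.2.2.subset hx
      have hyP := G.2.2.2.subset hy
      have hm : (1 / 2 : ℝ) • x + (1 / 2 : ℝ) • y ∈ G.1 :=
        G.2.2.1 hx hy (by norm_num) (by norm_num) (by norm_num)
      exact G.2.2.2.left_mem_of_mem_openSegment (y := (y.1, x.2)) ⟨hxP.1, hyP.2⟩ ⟨hyP.1, hxP.2⟩ hm
        ⟨1 / 2, 1 / 2, by norm_num, by norm_num, by norm_num,
          Prod.ext (by simp) (by simp [add_comm])⟩
    · exact fun h => ⟨Set.image_mono h, Set.image_mono h⟩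

/-- Linear isomorphisms preserve the face poset. -/
def FaceOf.preimageIso {E E' : Type} [AddCommGroup E] [Module ℝ E] [AddCommGroup E'] [Module ℝ E']
    (e : E ≃ₗ[ℝ] E') (A : Set E') : FaceOf (e ⁻¹' A) ≃o FaceOf A where
  toFun F := ⟨e.symm ⁻¹' F.1, F.2.1.preimage e.symm.surjective,
    F.2.2.1.is_linear_preimage e.symm.toLinearMap.isLinear,
    fun x hx => by simpa using F.2.2.2.subset hx, by
      rintro x hx y hy _ hz ⟨s, t, hs, ht, hst, rfl⟩
      exact F.2.2.2.left_mem_of_mem_openSegment (y := e.symm y) (by simpa using hx)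
        (by simpa using hy) hz ⟨s, t, hs, ht, hst, by simp⟩⟩
  invFun F := ⟨e ⁻¹' F.1, F.2.1.preimage e.surjective,
    F.2.2.1.is_linear_preimage e.toLinearMap.isLinear,
    fun x hx => F.2.2.2.subset hx, by
      rintro x hx y hy _ hz ⟨s, t, hs, ht, hst, rfl⟩
      exact F.2.2.2.left_mem_of_mem_openSegment (y := e y) hx hy hz ⟨s, t, hs, ht, hst, by simp⟩⟩
  left_inv F := Subtype.ext (by ext x; simp)
  right_inv F := Subtype.ext (by ext x; simp)
  map_rel_iff' := by
    intro F G
    exact ⟨fun h x hx => by simpa using @h (e x) (by simpa using hx), fun h x hx => h hx⟩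

/-- A convex polytope in some `ℝⁿ`: a nonempty bounded set which is the intersection of finitely
many closed half-spaces. -/
structure Polytope where
  /-- the dimension of the ambient space -/
  ambient : ℕ
  carrier : Set (Fin ambient → ℝ)
  nonempty : carrier.Nonempty
  bounded : Bornology.IsBounded carrier
  halfspaces : ∃ (ι : Type) (_ : Finite ι) (a : ι → ((Fin ambient → ℝ) →ₗ[ℝ] ℝ)) (b : ι → ℝ),
    carrier = {x | ∀ i, a i x ≤ b i}

namespace Polytope

theorem convex (P : Polytope) : Convex ℝ P.carrier := by
  obtain ⟨ι, _, a, b, h⟩ := P.halfspaces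
  rw [h, Set.ofPred_forall]
  exact convex_iInter fun i => convex_halfSpace_le (a i).isLinear (b i)

/-- The nonempty faces of a polytope, including the polytope itself. -/
abbrev Face (P : Polytope) : Type := FaceOf P.carrier

instance (P : Polytope) : OrderTop P.Face where
  top := ⟨P.carrier, P.nonempty, P.convex, IsExtreme.refl ℝ _⟩
  le_top F := F.2.2.2.subset

/-- A nonempty face is cut out by turning those inequalities into equalities that are tight on the
whole face. -/
theorem face_eq_tight {n : ℕ} {ι : Type} [Finite ι] (a : ι → ((Fin n → ℝ) →ₗ[ℝ] ℝ)) (b : ι → ℝ)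
    (F : Set (Fin n → ℝ)) (hne : F.Nonempty) (hc : Convex ℝ F)
    (he : IsExtreme ℝ {x | ∀ i, a i x ≤ b i} F) :
    F = {x | (∀ i, a i x ≤ b i) ∧ ∀ i, (∀ y ∈ F, a i y = b i) → a i x = b i} := by
  apply Set.Subset.antisymm
  · exact fun x hx => ⟨he.subset hx, fun i hi => hi x hx⟩
  rintro y ⟨hy, hyt⟩
  obtain ⟨x, hxF, hxmin⟩ := exists_minimalFor_of_wellFoundedLT (fun x => x ∈ F)
    (fun x => {i | a i x = b i}) hne
  have hx : ∀ i, a i x ≤ b i := he.subset hxF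
  have htight : ∀ i, a i x = b i → ∀ z ∈ F, a i z = b i := by
    intro i hi z hz
    have hz' : ∀ j, a j z ≤ b j := he.subset hz
    have hm : (1 / 2 : ℝ) • x + (1 / 2 : ℝ) • z ∈ F :=
      hc hxF hz (by norm_num) (by norm_num) (by norm_num)
    have hle := hxmin hm (by
      intro j hj
      simp only [Set.mem_ofPred_eq, map_add, map_smul, smul_eq_mul] at hj ⊢
      have := hx j
      have := hz' j
      linarith)
    have := hle hi
    simp only [Set.mem_ofPred_eq, map_add, map_smul, smul_eq_mul] at this
    linarith
  have hev : ∀ᶠ ε : ℝ in nhdsWithin 0 (Set.Ioi 0), ∀ i, a i x + ε * (a i x - a i y) ≤ b i := by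
    rw [Filter.eventually_all]
    intro i
    by_cases hi : a i x = b i
    · have hyi := hyt i (htight i hi)
      exact Filter.Eventually.of_forall fun ε => by rw [hi, hyi]; simp
    · have hlt : a i x + 0 * (a i x - a i y) < b i := by
        simpa using lt_of_le_of_ne (hx i) hi
      have hcont : Continuous fun ε : ℝ => a i x + ε * (a i x - a i y) := by fun_prop
      have := hcont.continuousAt.eventually (gt_mem_nhds hlt)
      exact (this.filter_mono nhdsWithin_le_nhds).mono fun ε h => le_of_lt h
  obtain ⟨ε, hε, hε0⟩ := (hev.and self_mem_nhdsWithin).exists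
  have hε0 : (0 : ℝ) < ε := hε0
  refine he.left_mem_of_mem_openSegment (x := y) hy (y := x + ε • (x - y)) ?_ hxF ?_
  · intro i
    simpa using hε i
  · refine ⟨ε / (1 + ε), 1 / (1 + ε), by positivity, by positivity,
      by rw [← add_div, add_comm, div_self (by positivity)], ?_⟩
    ext k
    simp only [Pi.add_apply, Pi.smul_apply, Pi.sub_apply, smul_eq_mul]
    field_simp
    ring

instance (P : Polytope) : Finite P.Face := by
  obtain ⟨ι, _, a, b, h⟩ := P.halfspaces
  refine Finite.of_injective
    (fun F : P.Face => ({i | ∀ y ∈ F.1, a i y = b i} : Set ι)) fun F G hFG => ?_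
  have hF := face_eq_tight a b F.1 F.2.1 F.2.2.1 (h ▸ F.2.2.2)
  have hG := face_eq_tight a b G.1 G.2.1 G.2.2.1 (h ▸ G.2.2.2)
  have hi : ∀ i, (∀ y ∈ F.1, a i y = b i) ↔ ∀ y ∈ G.1, a i y = b i :=
    fun i => Set.ext_iff.mp hFG i
  apply Subtype.ext
  rw [hF, hG]
  simp only [hi]

/-- A nonempty face of a polytope, as a polytope. -/
def Face.toPolytope {P : Polytope} (F : P.Face) : Polytope where
  ambient := P.ambient
  carrier := F.1
  nonempty := F.2.1
  bounded := P.bounded.subset F.2.2.2.subset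
  halfspaces := by
    obtain ⟨ι, _, a, b, h⟩ := P.halfspaces
    refine ⟨ι ⊕ {i // ∀ y ∈ F.1, a i y = b i}, inferInstance,
      Sum.elim a fun i => -a i.1, Sum.elim b fun i => -b i.1, ?_⟩
    refine (face_eq_tight a b F.1 F.2.1 F.2.2.1 (h ▸ F.2.2.2)).trans ?_
    ext x
    simp only [Set.mem_ofPred_eq, Sum.forall, Sum.elim_inl, Sum.elim_inr, LinearMap.neg_apply,
      neg_le_neg_iff, Subtype.forall]
    exact ⟨fun hx => ⟨hx.1, fun i hi => (hx.2 i hi).ge⟩,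
      fun hx => ⟨hx.1, fun i hi => le_antisymm (hx.1 i) (hx.2 i hi)⟩⟩

/-- The faces of a face `F` of `P` are the faces of `P` contained in `F`. -/
def Face.faceIso {P : Polytope} (F : P.Face) : F.toPolytope.Face ≃o Set.Iic F where
  toFun G := ⟨⟨G.1, G.2.1, G.2.2.1, F.2.2.2.trans G.2.2.2⟩, G.2.2.2.subset⟩
  invFun G := ⟨G.1.1, G.1.2.1, G.1.2.2.1, G.1.2.2.2.mono F.2.2.2.subset G.2⟩
  left_inv _ := rfl
  right_inv _ := rfl
  map_rel_iff' := Iff.rfl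

/-- Combinatorial equivalence: the face posets are isomorphic. -/
instance setoid : Setoid Polytope where
  r P Q := Nonempty (P.Face ≃o Q.Face)
  iseqv := ⟨fun _ => ⟨OrderIso.refl _⟩, fun ⟨e⟩ => ⟨e.symm⟩, fun ⟨e⟩ ⟨f⟩ => ⟨e.trans f⟩⟩

/-- The identification `ℝᵐ⁺ⁿ = ℝᵐ × ℝⁿ`. -/
def splitEquiv (m n : ℕ) : (Fin (m + n) → ℝ) ≃ₗ[ℝ] (Fin m → ℝ) × (Fin n → ℝ) where
  toFun x := (fun i => x (Fin.castAdd n i), fun j => x (Fin.natAdd m j))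
  invFun p := Fin.append p.1 p.2
  map_add' _ _ := rfl
  map_smul' _ _ := rfl
  left_inv _ := Fin.append_castAdd_natAdd
  right_inv _ := Prod.ext (by ext; simp) (by ext; simp)

/-- The product polytope `P × Q ⊆ ℝᵐ × ℝⁿ = ℝᵐ⁺ⁿ`. -/
def prod (P Q : Polytope) : Polytope where
  ambient := P.ambient + Q.ambient
  carrier := {x | (fun i => x (Fin.castAdd Q.ambient i)) ∈ P.carrier ∧
    (fun j => x (Fin.natAdd P.ambient j)) ∈ Q.carrier}
  nonempty := by
    obtain ⟨p, hp⟩ := P.nonempty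
    obtain ⟨q, hq⟩ := Q.nonempty
    exact ⟨Fin.append p q, by simpa using hp, by simpa using hq⟩
  bounded := by
    obtain ⟨c, hc⟩ := isBounded_iff_forall_norm_le.mp P.bounded
    obtain ⟨d, hd⟩ := isBounded_iff_forall_norm_le.mp Q.bounded
    refine isBounded_iff_forall_norm_le.mpr ⟨max c d, fun x hx => ?_⟩
    have h0 : 0 ≤ max c d := le_max_of_le_left ((norm_nonneg _).trans (hc _ hx.1))
    refine (pi_norm_le_iff_of_nonneg h0).mpr fun k => ?_
    refine Fin.addCases (fun i => ?_) (fun j => ?_) k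
    · exact le_max_of_le_left
        ((norm_le_pi_norm (fun i => x (Fin.castAdd Q.ambient i)) i).trans (hc _ hx.1))
    · exact le_max_of_le_right
        ((norm_le_pi_norm (fun j => x (Fin.natAdd P.ambient j)) j).trans (hd _ hx.2))
  halfspaces := by
    obtain ⟨ι, _, a, b, h⟩ := P.halfspaces
    obtain ⟨κ, _, a', b', h'⟩ := Q.halfspaces
    refine ⟨ι ⊕ κ, inferInstance,
      Sum.elim (fun i => a i ∘ₗ LinearMap.funLeft ℝ ℝ (Fin.castAdd Q.ambient))
        (fun i => a' i ∘ₗ LinearMap.funLeft ℝ ℝ (Fin.natAdd P.ambient)), Sum.elim b b', ?_⟩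
    rw [h, h']
    ext x
    simp only [Set.mem_ofPred_eq, Sum.forall, Sum.elim_inl, Sum.elim_inr, LinearMap.comp_apply]
    rfl

/-- The nonempty faces of a product polytope are the products of nonempty faces. -/
def prodFaceIso (P Q : Polytope) : (P.prod Q).Face ≃o P.Face × Q.Face :=
  (FaceOf.preimageIso (splitEquiv P.ambient Q.ambient) (P.carrier ×ˢ Q.carrier)).trans
    (FaceOf.prodIso P.carrier Q.carrier)

/-- The one-point polytope `ℝ⁰`. -/
def point : Polytope where
  ambient := 0
  carrier := Set.univ
  nonempty := Set.univ_nonempty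
  bounded := Set.finite_univ.isBounded
  halfspaces := ⟨Empty, inferInstance, fun i => i.elim, fun i => i.elim, by
    ext x
    exact iff_of_true trivial fun i => i.elim⟩

instance : Unique point.Face where
  default := ⊤
  uniq F := by
    apply Subtype.ext
    obtain ⟨x, hx⟩ := F.2.1
    exact Set.eq_univ_of_forall fun y => (funext fun i => i.elim0 : x = y) ▸ hx

/-- The product of two isomorphisms of ordered sets. -/
def prodMap {α β γ δ : Type} [LE α] [LE β] [LE γ] [LE δ] (e : α ≃o β) (f : γ ≃o δ) :
    α × γ ≃o β × δ where
  toEquiv := e.toEquiv.prodCongr f.toEquiv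
  map_rel_iff' := and_congr e.le_iff_le f.le_iff_le

/-- The set of combinatorial types of convex polytopes. -/
abbrev Class : Type := Quotient Polytope.setoid

/-- The combinatorial type of a polytope. -/
def toClass (P : Polytope) : Class := Quotient.mk _ P

/-- The commutative monoid of combinatorial types under the product of polytopes. -/
instance : CommMonoid Class where
  mul := Quotient.map₂ prod fun P P' ⟨e⟩ Q Q' ⟨f⟩ =>
    ⟨(prodFaceIso P Q).trans ((prodMap e f).trans (prodFaceIso P' Q').symm)⟩
  one := toClass point
  mul_assoc := by
    rintro ⟨P⟩ ⟨Q⟩ ⟨R⟩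
    exact Quotient.sound ⟨(prodFaceIso _ _).trans
      (((prodMap (prodFaceIso P Q) (OrderIso.refl _)).trans
        ((OrderIso.prodAssoc _ _ _).trans
          (prodMap (OrderIso.refl _) (prodFaceIso Q R).symm))).trans (prodFaceIso _ _).symm)⟩
  mul_comm := by
    rintro ⟨P⟩ ⟨Q⟩
    exact Quotient.sound ⟨(prodFaceIso P Q).trans
      (OrderIso.prodComm.trans (prodFaceIso Q P).symm)⟩
  one_mul := by
    rintro ⟨P⟩
    exact Quotient.sound ⟨(prodFaceIso point P).trans
      { Equiv.uniqueProd P.Face point.Face with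
        map_rel_iff' := fun {x y} => ⟨fun h => ⟨(Subsingleton.elim x.1 y.1).le, h⟩, fun h => h.2⟩ }⟩
  mul_one := by
    rintro ⟨P⟩
    exact Quotient.sound ⟨(prodFaceIso P point).trans
      { Equiv.prodUnique P.Face point.Face with
        map_rel_iff' := fun {x y} => ⟨fun h => ⟨h, (Subsingleton.elim x.2 y.2).le⟩, fun h => h.1⟩ }⟩

/-- The ring of polytopes: the free abelian group on the combinatorial types of convex polytopes,
with the multiplication that extends the product of polytopes. -/
abbrev PRing : Type := FreeAbelianGroup Class

/-- The element of the ring of polytopes given by a polytope. -/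
def toRing (P : Polytope) : PRing := FreeAbelianGroup.of P.toClass

/-- The boundary of a polytope: the sum of its facets (maximal proper faces). -/
noncomputable def boundary (P : Polytope) : PRing :=
  ∑ᶠ F : {F : P.Face // IsCoatom F}, F.1.toPolytope.toRing

theorem boundary_congr {P Q : Polytope} (h : P ≈ Q) : P.boundary = Q.boundary := by
  obtain ⟨e⟩ := h
  refine finsum_eq_of_bijective
    (fun F : {F : P.Face // IsCoatom F} =>
      (⟨e F.1, (e.isCoatom_iff F.1).mpr F.2⟩ : {F : Q.Face // IsCoatom F})) ⟨?_, ?_⟩ ?_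
  · intro F G hFG
    exact Subtype.ext (e.injective (congrArg Subtype.val hFG))
  · intro G
    exact ⟨⟨e.symm G.1, (e.symm.isCoatom_iff G.1).mpr G.2⟩,
      Subtype.ext (e.apply_symm_apply G.1)⟩
  · intro F
    refine congrArg FreeAbelianGroup.of (Quotient.sound ⟨F.1.faceIso.trans
      (OrderIso.trans ?_ (Face.faceIso _).symm)⟩)
    exact
      { toFun := fun G => ⟨e G.1, e.monotone G.2⟩
        invFun := fun G => ⟨e.symm G.1, (e.symm_apply_le).mpr G.2⟩
        left_inv := fun G => Subtype.ext (e.symm_apply_apply G.1)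
        right_inv := fun G => Subtype.ext (e.apply_symm_apply G.1)
        map_rel_iff' := fun {x y} => e.le_iff_le }

/-- The additive map `d` on the ring of polytopes with `d P` the boundary of `P`. -/
noncomputable def d : PRing →+ PRing :=
  FreeAbelianGroup.lift (Quotient.lift boundary fun _ _ h => boundary_congr h)

end Polytope

namespace SimpleGraph

/-- The graph `Γ / S` on the vertices outside `S`: two distinct vertices `i`, `j` are adjacent when
they are joined by a path in the subgraph induced on `S ∪ {i, j}`. -/
def contraction {V : Type} (Γ : SimpleGraph V) (S : Set V) : SimpleGraph {v // v ∉ S} where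
  Adj i j := i ≠ j ∧ (Γ.induce (S ∪ {i.1, j.1})).Reachable ⟨i.1, by simp⟩ ⟨j.1, by simp⟩
  symm := ⟨fun i j h => ⟨h.1.symm, by
    have key : ∀ (T T' : Set V), T = T' → ∀ a b (ha : a ∈ T) (hb : b ∈ T) (ha' : a ∈ T')
        (hb' : b ∈ T'), (Γ.induce T).Reachable ⟨a, ha⟩ ⟨b, hb⟩ →
        (Γ.induce T').Reachable ⟨b, hb'⟩ ⟨a, ha'⟩ := by
      rintro T _ rfl a b _ _ _ _ h
      exact h.symm
    exact key _ _ (by rw [Set.pair_comm]) i.1 j.1 _ _ _ _ h.2⟩⟩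
  loopless := ⟨fun _ h => h.1 rfl⟩

/-- The graph-associahedron of a graph with vertices `0, …, k`, as the set of `x` with
`∑ᵢ xᵢ = 3^(k+1)` and `∑_{i ∈ S} xᵢ ≥ 3^|S|` for all proper vertex subsets `S` that induce a
connected (in particular nonempty) subgraph. -/
def associahedronSet {k : ℕ} (Γ : SimpleGraph (Fin (k + 1))) : Set (Fin (k + 1) → ℝ) :=
  {x | ∑ i, x i = 3 ^ (k + 1) ∧ ∀ S : Finset (Fin (k + 1)),
    (Γ.induce (S : Set (Fin (k + 1)))).Connected → S ≠ Finset.univ →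
      (3 : ℝ) ^ S.card ≤ ∑ i ∈ S, x i}

theorem pow_card_le {k : ℕ} (S : Finset (Fin (k + 1))) (hS : S.Nonempty) :
    (3 : ℝ) ^ S.card ≤ ∑ i ∈ S, (if (i : ℕ) = 0 then 3 else 2 * 3 ^ (i : ℕ) : ℝ) := by
  induction S using Finset.induction_on_max with
  | empty => simp at hS
  | insert a s hlt ih =>
    have ha : a ∉ s := fun h => lt_irrefl _ (hlt a h)
    rw [Finset.sum_insert ha, Finset.card_insert_of_notMem ha]
    rcases s.eq_empty_or_nonempty with rfl | hs
    · simp only [Finset.card_empty, Finset.sum_empty, add_zero]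
      split_ifs with h0
      · norm_num
      · have : (3 : ℝ) ^ 1 ≤ 3 ^ (a : ℕ) := pow_le_pow_right₀ (by norm_num) (by omega)
        norm_num at this ⊢
        linarith
    · have hca : s.card ≤ (a : ℕ) := by
        have : s ⊆ Finset.Iio a := fun x hx => Finset.mem_Iio.mpr (hlt x hx)
        simpa using Finset.card_le_card this
      have h0 : (a : ℕ) ≠ 0 := by
        have := hs.card_pos
        omega
      have h1 := ih hs
      have h2 : (3 : ℝ) ^ s.card ≤ 3 ^ (a : ℕ) := pow_le_pow_right₀ (by norm_num) hca
      rw [if_neg h0, pow_succ]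
      linarith

theorem sum_pow (k : ℕ) :
    ∑ i : Fin (k + 1), (if (i : ℕ) = 0 then 3 else 2 * 3 ^ (i : ℕ) : ℝ) = 3 ^ (k + 1) := by
  induction k with
  | zero => simp
  | succ k ih =>
    rw [Fin.sum_univ_castSucc]
    simp only [Fin.val_castSucc, ih, Fin.val_last]
    rw [if_neg (by omega)]
    ring

theorem connected_singleton {k : ℕ} (Γ : SimpleGraph (Fin (k + 1))) (i : Fin (k + 1)) :
    (Γ.induce (({i} : Finset (Fin (k + 1))) : Set (Fin (k + 1)))).Connected := by
  rw [Finset.coe_singleton]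
  exact ⟨fun x y => by rw [Subsingleton.elim x y]⟩

/-- The graph-associahedron `P_Γ` of a graph with vertices `0, …, k`, as a polytope in `ℝᵏ⁺¹`. -/
def associahedron {k : ℕ} (Γ : SimpleGraph (Fin (k + 1))) : Polytope where
  ambient := k + 1
  carrier := Γ.associahedronSet
  nonempty := ⟨fun i => if (i : ℕ) = 0 then 3 else 2 * 3 ^ (i : ℕ), sum_pow k, fun S hS _ =>
    pow_card_le S (Set.nonempty_coe_sort.mp hS.nonempty)⟩
  bounded := by
    refine isBounded_iff_forall_norm_le.mpr ⟨3 ^ (k + 1), fun x hx => ?_⟩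
    have h0 : ∀ i, 0 ≤ x i := by
      intro i
      by_cases hi : ({i} : Finset (Fin (k + 1))) = Finset.univ
      · have := hx.1
        rw [← hi, Finset.sum_singleton] at this
        rw [this]
        positivity
      · have := hx.2 {i} (connected_singleton Γ i) hi
        simp only [Finset.card_singleton, Finset.sum_singleton] at this
        linarith
    refine (pi_norm_le_iff_of_nonneg (by positivity)).mpr fun i => ?_
    rw [Real.norm_eq_abs, abs_of_nonneg (h0 i), ← hx.1]
    exact Finset.single_le_sum (fun j _ => h0 j) (Finset.mem_univ i)
  halfspaces := by
    refine ⟨Option (Option {S : Finset (Fin (k + 1)) //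
        (Γ.induce (S : Set (Fin (k + 1)))).Connected ∧ S ≠ Finset.univ}), inferInstance,
      fun o => o.elim (∑ i, LinearMap.proj i) fun o => o.elim (-∑ i, LinearMap.proj i)
        fun S => -∑ i ∈ S.1, LinearMap.proj i,
      fun o => o.elim (3 ^ (k + 1)) fun o => o.elim (-3 ^ (k + 1)) fun S => -3 ^ S.1.card, ?_⟩
    ext x
    simp only [associahedronSet, Set.mem_ofPred_eq, Option.forall, Option.elim, Subtype.forall,
      LinearMap.neg_apply, LinearMap.sum_apply, LinearMap.proj_apply, neg_le_neg_iff, and_imp]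
    exact ⟨fun h => ⟨h.1.le, h.1.ge, h.2⟩, fun h => ⟨le_antisymm h.1 h.2.1, h.2.2⟩⟩

end SimpleGraph

/-!
The facets of a graph-associahedron `P_Γ` correspond to the proper sets `S` of vertices which induce
a connected subgraph, and the facet of `S` is combinatorially `P_{Γ|S} × P_{Γ/S}`.

On the facet `x(S) = c S` of the polytope `x(V) = c V`, `x(T) ≥ c T`, the coordinates in `S` and
those outside `S` vary independently in two polytopes of the same kind, for `Γ|S` and `Γ/S`
(`SimpleGraph.mem_facet_iff`). For `Γ/S` the right-hand sides are no longer powers of three, so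
arbitrary right-hand sides `c` are allowed that satisfy `c A + c B < c (A ∪ B)` for incomparable
connected sets `A`, `B` with connected union (`SimpleGraph.Admissible`). The faces of a polyhedron
are determined by the sets of inequalities that are simultaneously tight, and by induction on the
number of vertices, through facets, these sets do not depend on `c`
(`SimpleGraph.exists_same_tight`). The induction ends at a point in the interior, which exists since
the inequality of a proper connected set `T` is strict on the facet of any neighbour of `T`.

Since the ring of polytopes is free on combinatorial types and the boundary of a polytope is a sum
without cancellation, a subring generated by polytopes is closed under `d` if and only if every
facet of a generator is a product of generators (`Polytope.subring_closed_iff`). For paths and for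
complete graphs this holds because restrictions and contractions are again paths or complete graphs.

Conversely, let the subring of a family `Γ` be closed. Then the graphs whose associahedra are
products of members of the family form a class closed under restriction and contraction. Counting
facets shows that with a hexagon in the family, no pentagon is such a product, and that with a
pentagon in the family, no hexagon is; the only coincidence of facet numbers is that of the hexagon
and the cube, which differ in the facets of their facets. So on three vertices the class contains
only triangles, or only paths. The same holds for the class of all graphs isomorphic to a member of
the family under the hypothesis of the graph lemma. In both cases `SimpleGraph.paths_or_complete`
applies: a connected graph that is not complete has an induced path on three vertices, and a
connected graph that is not a path has a triangle after contracting at most one connected set.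
-/

/-! ### Connected vertex sets and contractions -/

namespace SimpleGraph

variable {V : Type} {Γ : SimpleGraph V}

/-- The induction principle that comes with a walk inside `T`: a set of vertices which contains the
start and is stable under adjacency within `T` contains the end. -/
theorem Reachable.mem_of_closed {T : Set V} {a b : T} (h : (Γ.induce T).Reachable a b)
    {A : Set V} (ha : a.1 ∈ A) (hA : ∀ x ∈ A, x ∈ T → ∀ y ∈ T, Γ.Adj x y → y ∈ A) : b.1 ∈ A := by
  rw [reachable_iff_reflTransGen] at h
  induction h with
  | refl => exact ha
  | tail _ hadj ih => exact hA _ ih (Subtype.property _) _ (Subtype.property _) hadj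

/-- Connectedness of an induced subgraph as an induction principle. This is the form in which
connectedness is established and used below. -/
theorem induce_connected_iff {T : Set V} : (Γ.induce T).Connected ↔ T.Nonempty ∧
    ∀ A : Set V, (∃ x ∈ A, x ∈ T) → (∀ x ∈ A, x ∈ T → ∀ y ∈ T, Γ.Adj x y → y ∈ A) → T ⊆ A := by
  constructor
  · intro h
    refine ⟨Set.nonempty_coe_sort.mp h.nonempty, fun A ⟨x, hxA, hxT⟩ hA y hy => ?_⟩
    exact (h.preconnected ⟨x, hxT⟩ ⟨y, hy⟩).mem_of_closed hxA hA
  · rintro ⟨hne, h⟩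
    have := hne.to_subtype
    refine ⟨fun a b => ?_⟩
    have := h {v | ∃ hv : v ∈ T, (Γ.induce T).Reachable a ⟨v, hv⟩} ⟨a.1, ⟨a.2, .rfl⟩, a.2⟩
      (fun x ⟨hx, hax⟩ _ y hy hxy => ⟨hy, hax.trans (Adj.reachable (G := Γ.induce T) hxy)⟩) b.2
    exact this.2

theorem induce_singleton_connected (v : V) : (Γ.induce {v}).Connected := by
  refine induce_connected_iff.mpr ⟨⟨v, rfl⟩, ?_⟩
  rintro A ⟨x, hx, rfl⟩ _ _ rfl
  exact hx

theorem induce_univ_connected_iff : (Γ.induce Set.univ).Connected ↔ Γ.Connected :=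
  (induceUnivIso Γ).connected_iff

/-- The union of two connected sets which are joined by an edge is connected. -/
theorem induce_union_connected_of_adj {T U : Set V} (hT : (Γ.induce T).Connected)
    (hU : (Γ.induce U).Connected) {t u : V} (ht : t ∈ T) (hu : u ∈ U) (h : Γ.Adj t u) :
    (Γ.induce (T ∪ U)).Connected := by
  rw [induce_connected_iff] at hT hU ⊢
  refine ⟨⟨t, .inl ht⟩, ?_⟩
  rintro A ⟨x, hxA, hx⟩ hA
  have hTA : (∃ x ∈ A, x ∈ T) → T ⊆ A := fun h =>
    hT.2 A h fun x hx hxT y hy hxy => hA x hx (.inl hxT) y (.inl hy) hxy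
  have hUA : (∃ x ∈ A, x ∈ U) → U ⊆ A := fun h =>
    hU.2 A h fun x hx hxT y hy hxy => hA x hx (.inr hxT) y (.inr hy) hxy
  rcases hx with hx | hx
  · have h1 := hTA ⟨x, hxA, hx⟩
    exact Set.union_subset h1 (hUA ⟨u, hA t (h1 ht) (.inl ht) u (.inr hu) h, hu⟩)
  · have h1 := hUA ⟨x, hxA, hx⟩
    exact Set.union_subset (hTA ⟨t, hA u (h1 hu) (.inr hu) t (.inl ht) h.symm, ht⟩) h1

theorem induce_union_connected_of_inter {T U : Set V} (hT : (Γ.induce T).Connected)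
    (hU : (Γ.induce U).Connected) {t : V} (ht : t ∈ T) (hu : t ∈ U) :
    (Γ.induce (T ∪ U)).Connected :=
  induce_union_connected hT.preconnected hU.preconnected ⟨t, ht, hu⟩

theorem induce_pair_connected {a b : V} (h : Γ.Adj a b) : (Γ.induce {a, b}).Connected :=
  induce_union_connected_of_adj (induce_singleton_connected a) (induce_singleton_connected b)
    rfl rfl h

/-- A proper nonempty set of vertices of a connected graph has an edge leaving it. -/
theorem Connected.exists_adj_of_ne_univ (h : Γ.Connected) {T : Set V} (hT : T.Nonempty)
    (hne : T ≠ Set.univ) : ∃ t ∈ T, ∃ v ∉ T, Γ.Adj t v := by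
  by_contra! hc
  obtain ⟨x, hx⟩ := hT
  refine hne (Set.univ_subset_iff.mp ((induce_connected_iff.mp
    (induce_univ_connected_iff.mpr h)).2 T ⟨x, hx, trivial⟩ fun x hx _ y _ hxy => ?_))
  by_contra hy
  exact hc x hx y hy hxy

/-- Connected sets of an induced subgraph are connected sets of the graph. -/
theorem induce_induce_connected_iff {S : Set V} {T : Set S} :
    ((Γ.induce S).induce T).Connected ↔ (Γ.induce (Subtype.val '' T)).Connected := by
  rw [induce_connected_iff, induce_connected_iff, Set.image_nonempty]
  refine and_congr_right fun _ => ⟨fun h A hA hcl => ?_, fun h A hA hcl => ?_⟩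
  · obtain ⟨_, hx, y, hy, rfl⟩ := hA
    have := h (Subtype.val ⁻¹' A) ⟨y, hx, hy⟩
      fun x hx hxT y hy hxy => hcl _ hx ⟨x, hxT, rfl⟩ _ ⟨y, hy, rfl⟩ hxy
    exact Set.image_subset_iff.mpr this
  · obtain ⟨x, hx, hxT⟩ := hA
    have := h (Subtype.val '' A) ⟨x, ⟨x, hx, rfl⟩, ⟨x, hxT, rfl⟩⟩ (by
      rintro _ ⟨x, hx, rfl⟩ ⟨x', hxT, hx'⟩ _ ⟨y, hy, rfl⟩ hxy
      obtain rfl := Subtype.ext hx'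
      exact ⟨y, hcl _ hx hxT y hy hxy, rfl⟩)
    exact (Set.image_subset_image_iff Subtype.val_injective).mp this

/-- Contracting a connected set `S` joins two vertices precisely when they were adjacent before or
both have a neighbour in `S`. -/
theorem contraction_adj_iff {S : Set V} (hS : (Γ.induce S).Connected) {i j : {v // v ∉ S}} :
    (Γ.contraction S).Adj i j ↔
      i ≠ j ∧ (Γ.Adj i.1 j.1 ∨ (∃ s ∈ S, Γ.Adj i.1 s) ∧ ∃ s ∈ S, Γ.Adj j.1 s) := by
  refine and_congr_right fun hij => ⟨fun h => ?_, fun h => ?_⟩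
  · by_contra! hc
    have hij' : i.1 ≠ j.1 := fun h => hij (Subtype.ext h)
    by_cases hi : ∃ s ∈ S, Γ.Adj i.1 s
    · have := hc.2 hi
      refine hij' (h.symm.mem_of_closed (A := {j.1}) rfl ?_)
      rintro _ rfl _ y (hy | rfl | rfl) hxy
      · exact (this y hy hxy).elim
      · exact (hc.1 hxy.symm).elim
      · rfl
    · push Not at hi
      refine hij' (h.mem_of_closed (A := {i.1}) rfl ?_).symm
      rintro _ rfl _ y (hy | rfl | rfl) hxy
      · exact (hi y hy hxy).elim
      · rfl
      · exact (hc.1 hxy).elim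
  · rcases h with h | ⟨⟨s, hs, hi⟩, s', hs', hj⟩
    · exact Adj.reachable (G := Γ.induce (S ∪ {i.1, j.1})) h
    · have h1 := induce_union_connected_of_adj hS (induce_singleton_connected i.1) hs rfl hi.symm
      have h2 := induce_union_connected_of_adj h1 (induce_singleton_connected j.1)
        (.inl hs') rfl hj.symm
      rw [Set.union_assoc, Set.singleton_union] at h2
      exact h2.preconnected _ _

/-- A nonempty set `T` is connected after contracting the connected set `S` if and only if `T` or
`T ∪ S` is connected. -/
theorem contraction_induce_connected_iff {S : Set V} (hS : (Γ.induce S).Connected)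
    {T : Set {v // v ∉ S}} : ((Γ.contraction S).induce T).Connected ↔ T.Nonempty ∧
      ((Γ.induce (Subtype.val '' T)).Connected ∨ (Γ.induce (Subtype.val '' T ∪ S)).Connected) := by
  have hSc := induce_connected_iff.mp hS
  constructor
  · intro h
    have hT := induce_connected_iff.mp h
    refine ⟨hT.1, ?_⟩
    by_cases hall : ∀ i ∈ T, ∀ j ∈ T, (Γ.contraction S).Adj i j → Γ.Adj i.1 j.1
    · left
      refine induce_connected_iff.mpr ⟨hT.1.image _, ?_⟩
      rintro A ⟨_, hx, x, hxT, rfl⟩ hA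
      refine Set.image_subset_iff.mpr (hT.2 (Subtype.val ⁻¹' A) ⟨x, hx, hxT⟩ ?_)
      exact fun x hx hxT y hy hxy => hA _ hx ⟨x, hxT, rfl⟩ _ ⟨y, hy, rfl⟩ (hall x hxT y hy hxy)
    · right
      push Not at hall
      obtain ⟨i, hi, j, hj, hij, hn⟩ := hall
      obtain ⟨-, hij | ⟨⟨s, hs, his⟩, -⟩⟩ := (contraction_adj_iff hS).mp hij
      · exact absurd hij hn
      refine induce_connected_iff.mpr ⟨⟨i.1, .inl ⟨i, hi, rfl⟩⟩, ?_⟩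
      intro A hA hcl
      have hSA : (∃ x ∈ A, x ∈ S) → S ⊆ A := fun h =>
        hSc.2 A h fun x hx hxS y hy hxy => hcl x hx (.inr hxS) y (.inr hy) hxy
      have hTA : (∃ x ∈ T, x.1 ∈ A) → Subtype.val '' T ⊆ A := fun ⟨x, hxT, hxA⟩ => by
        refine Set.image_subset_iff.mpr (hT.2 (Subtype.val ⁻¹' A) ⟨x, hxA, hxT⟩ ?_)
        intro x hx hxT y hy hxy
        obtain ⟨-, hxy | ⟨⟨s, hs, hxs⟩, s', hs', hys⟩⟩ := (contraction_adj_iff hS).mp hxy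
        · exact hcl _ hx (.inl ⟨x, hxT, rfl⟩) _ (.inl ⟨y, hy, rfl⟩) hxy
        · have := hSA ⟨s, hcl _ hx (.inl ⟨x, hxT, rfl⟩) s (.inr hs) hxs, hs⟩
          exact hcl s' (this hs') (.inr hs') _ (.inl ⟨y, hy, rfl⟩) hys.symm
      obtain ⟨_, hxA, ⟨x, hxT, rfl⟩ | hxS⟩ := hA
      · have h1 := hTA ⟨x, hxT, hxA⟩
        exact Set.union_subset h1 (hSA
          ⟨s, hcl _ (h1 ⟨i, hi, rfl⟩) (.inl ⟨i, hi, rfl⟩) s (.inr hs) his, hs⟩)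
      · have h1 := hSA ⟨_, hxA, hxS⟩
        exact Set.union_subset
          (hTA ⟨i, hi, hcl s (h1 hs) (.inr hs) _ (.inl ⟨i, hi, rfl⟩) his.symm⟩) h1
  · rintro ⟨hne, h⟩
    refine induce_connected_iff.mpr ⟨hne, ?_⟩
    rintro A ⟨x, hxA, hxT⟩ hcl
    rcases h with h | h
    · have := (induce_connected_iff.mp h).2 (Subtype.val '' A) ⟨x, ⟨x, hxA, rfl⟩, ⟨x, hxT, rfl⟩⟩ (by
        rintro _ ⟨x, hx, rfl⟩ ⟨x', hxT, hx'⟩ _ ⟨y, hy, rfl⟩ hxy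
        obtain rfl := Subtype.ext hx'
        exact ⟨y, hcl _ hx hxT y hy ((contraction_adj_iff hS).mpr
          ⟨fun h => hxy.ne (congrArg _ h), .inl hxy⟩), rfl⟩)
      exact (Set.image_subset_image_iff Subtype.val_injective).mp this
    · have := (induce_connected_iff.mp h).2
        (Subtype.val '' (A ∩ T) ∪ {s | s ∈ S ∧ ∃ x ∈ A ∩ T, ∃ s' ∈ S, Γ.Adj x.1 s'})
        ⟨x, .inl ⟨x, ⟨hxA, hxT⟩, rfl⟩, .inl ⟨x, hxT, rfl⟩⟩ (by
        rintro _ (⟨x, hx, rfl⟩ | ⟨hzS, x, hx, s', hs', hxs⟩) - _ (⟨y, hy, rfl⟩ | hyS) hxy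
        · exact .inl ⟨y, ⟨hcl _ hx.1 hx.2 y hy ((contraction_adj_iff hS).mpr
            ⟨fun h => hxy.ne (congrArg _ h), .inl hxy⟩), hy⟩, rfl⟩
        · exact .inr ⟨hyS, x, hx, _, hyS, hxy⟩
        · by_cases hxy' : x = y
          · subst hxy'
            exact .inl ⟨x, hx, rfl⟩
          · exact .inl ⟨y, ⟨hcl _ hx.1 hx.2 y hy ((contraction_adj_iff hS).mpr
              ⟨hxy', .inr ⟨⟨s', hs', hxs⟩, _, hzS, hxy.symm⟩⟩), hy⟩, rfl⟩
        · exact .inr ⟨hyS, x, hx, s', hs', hxs⟩)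
      intro y hy
      obtain ⟨z, hz, hzy⟩ | ⟨hyS, -⟩ := this (.inl ⟨y, hy, rfl⟩)
      · exact Subtype.ext hzy ▸ hz.1
      · exact absurd hyS y.2

theorem val_image_univ_union (S : Set V) :
    Subtype.val '' (Set.univ : Set {v // v ∉ S}) ∪ S = Set.univ := by
  ext v
  by_cases hv : v ∈ S <;> simp [hv]

theorem contraction_connected (hΓ : Γ.Connected) {S : Set V} (hS : (Γ.induce S).Connected)
    (hne : S ≠ Set.univ) : (Γ.contraction S).Connected := by
  rw [← induce_univ_connected_iff, contraction_induce_connected_iff hS, val_image_univ_union]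
  obtain ⟨v, hv⟩ := (Set.ne_univ_iff_exists_notMem S).mp hne
  exact ⟨⟨⟨v, hv⟩, trivial⟩, .inr (induce_univ_connected_iff.mpr hΓ)⟩

end SimpleGraph

/-! ### Faces and tight constraints -/

section Polyhedron

variable {E E' ι : Type} [AddCommGroup E] [Module ℝ E] [AddCommGroup E'] [Module ℝ E']

/-- A convex set on which finitely many linear inequalities hold has a point at which only those
inequalities are tight that are tight on the whole set. -/
theorem Convex.exists_generic [Finite ι] {A : Set E} (hA : Convex ℝ A) (hne : A.Nonempty)
    (a : ι → E →ₗ[ℝ] ℝ) (b : ι → ℝ) (hab : ∀ x ∈ A, ∀ i, b i ≤ a i x) :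
    ∃ x ∈ A, ∀ i, a i x = b i → ∀ z ∈ A, a i z = b i := by
  obtain ⟨x, hxA, hxmin⟩ := exists_minimalFor_of_wellFoundedLT (fun x => x ∈ A)
    (fun x => {i | a i x = b i}) hne
  refine ⟨x, hxA, fun i hi z hz => ?_⟩
  have hm : (1 / 2 : ℝ) • x + (1 / 2 : ℝ) • z ∈ A :=
    hA hxA hz (by norm_num) (by norm_num) (by norm_num)
  have hle := hxmin hm fun j hj => by
    simp only [Set.mem_ofPred_eq, map_add, map_smul, smul_eq_mul] at hj ⊢
    have := hab x hxA j
    have := hab z hz j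
    linarith
  have := hle hi
  simp only [Set.mem_ofPred_eq, map_add, map_smul, smul_eq_mul] at this
  linarith

/-- The set cut out by one linear equation and a family of linear inequalities. -/
def polyhedron (g : E →ₗ[ℝ] ℝ) (r : ℝ) (a : ι → E →ₗ[ℝ] ℝ) (b : ι → ℝ) : Set E :=
  {x | g x = r ∧ ∀ i, b i ≤ a i x}

variable {g : E →ₗ[ℝ] ℝ} {r : ℝ} {a : ι → E →ₗ[ℝ] ℝ} {b : ι → ℝ}
  {g' : E' →ₗ[ℝ] ℝ} {r' : ℝ} {a' : ι → E' →ₗ[ℝ] ℝ} {b' : ι → ℝ}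

theorem convex_polyhedron : Convex ℝ (polyhedron g r a b) := by
  refine (convex_hyperplane g.isLinear r).inter (t := {x | ∀ i, b i ≤ a i x}) ?_
  rw [Set.ofPred_forall]
  exact convex_iInter fun i => convex_halfSpace_ge (a i).isLinear (b i)

/-- A face that contains `x` contains all points at which at least the inequalities tight at `x` are
tight. -/
theorem IsExtreme.mem_of_tight [Finite ι] {F : Set E} (he : IsExtreme ℝ (polyhedron g r a b) F)
    {x y : E} (hxF : x ∈ F) (hy : y ∈ polyhedron g r a b)
    (h : ∀ i, a i x = b i → a i y = b i) : y ∈ F := by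
  have hx := he.subset hxF
  -- the segment from `y` through `x` can be extended slightly beyond `x`
  have hev : ∀ᶠ ε : ℝ in nhdsWithin 0 (Set.Ioi 0), ∀ i, b i ≤ a i x + ε * (a i x - a i y) := by
    rw [Filter.eventually_all]
    intro i
    by_cases hi : a i x = b i
    · exact Filter.Eventually.of_forall fun ε => by rw [hi, h i hi]; simp
    · have hlt : b i < a i x + 0 * (a i x - a i y) := by
        simpa using lt_of_le_of_ne (hx.2 i) (Ne.symm hi)
      have hcont : Continuous fun ε : ℝ => a i x + ε * (a i x - a i y) := by fun_prop
      have := hcont.continuousAt.eventually (lt_mem_nhds hlt)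
      exact (this.filter_mono nhdsWithin_le_nhds).mono fun ε h => le_of_lt h
  obtain ⟨ε, hε, hε0⟩ := (hev.and self_mem_nhdsWithin).exists
  have hε0 : (0 : ℝ) < ε := hε0
  refine he.left_mem_of_mem_openSegment (x := y) hy (y := x + ε • (x - y)) ⟨?_, ?_⟩ hxF ?_
  · simp [hx.1, hy.1]
  · intro i
    simpa using hε i
  · refine ⟨ε / (1 + ε), 1 / (1 + ε), by positivity, by positivity,
      by rw [← add_div, add_comm, div_self (by positivity)], ?_⟩
    match_scalars <;> field_simp
    ring

/-- The points of a polyhedron at which a given set of inequalities is tight form a face. -/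
theorem isExtreme_tight (N : Set ι) :
    IsExtreme ℝ (polyhedron g r a b) {x ∈ polyhedron g r a b | ∀ i ∈ N, a i x = b i} := by
  refine ⟨fun x hx => hx.1, ?_⟩
  rintro x hx y hy _ ⟨-, hz⟩ ⟨s, t, hs, ht, hst, rfl⟩
  refine ⟨hx, fun i hi => ?_⟩
  have h1 := hz i hi
  simp only [map_add, map_smul, smul_eq_mul] at h1
  have h2 := mul_nonneg ht.le (sub_nonneg.mpr (hy.2 i))
  have h3 : s * (a i x - b i) ≤ 0 := by
    linear_combination h1 - (b i) * hst + h2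
  exact le_antisymm (by nlinarith) (hx.2 i)

theorem convex_tight (N : Set ι) :
    Convex ℝ {x ∈ polyhedron g r a b | ∀ i ∈ N, a i x = b i} := by
  refine convex_polyhedron.inter (t := {x | ∀ i ∈ N, a i x = b i}) ?_
  simp only [Set.ofPred_forall]
  exact convex_iInter₂ fun i _ => convex_hyperplane (a i).isLinear (b i)

/-- The inequalities that are tight on a face. -/
def FaceOf.tight (F : FaceOf (polyhedron g r a b)) : Set ι := {i | ∀ y ∈ F.1, a i y = b i}

theorem FaceOf.exists_generic [Finite ι] (F : FaceOf (polyhedron g r a b)) :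
    ∃ x ∈ F.1, F.tight = {i | a i x = b i} := by
  obtain ⟨x, hx, h⟩ := F.2.2.1.exists_generic F.2.1 a b fun x hx => (F.2.2.2.subset hx).2
  exact ⟨x, hx, Set.Subset.antisymm (fun i hi => hi x hx) h⟩

theorem FaceOf.le_iff_tight [Finite ι] {F G : FaceOf (polyhedron g r a b)} :
    F ≤ G ↔ G.tight ⊆ F.tight := by
  constructor
  · exact fun h i hi y hy => hi y (h hy)
  · intro h y hy
    obtain ⟨x, hx, hxG⟩ := G.exists_generic
    exact G.2.2.2.mem_of_tight hx (F.2.2.2.subset hy) fun i hi => h (hxG.symm.subset hi) y hy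

/-- A face is determined by the inequalities that are tight on it, in an order reversing way. -/
def FaceOf.tightEmbedding [Finite ι] : FaceOf (polyhedron g r a b) ↪o (Set ι)ᵒᵈ :=
  OrderEmbedding.ofMapLEIff (fun F => OrderDual.toDual F.tight) fun _ _ => FaceOf.le_iff_tight.symm

/-- The face of all points at which at least the inequalities in `N` are tight. -/
def FaceOf.ofTight (N : Set ι) (h : ∃ x ∈ polyhedron g r a b, ∀ i ∈ N, a i x = b i) :
    FaceOf (polyhedron g r a b) :=
  ⟨{x ∈ polyhedron g r a b | ∀ i ∈ N, a i x = b i}, h, convex_tight N, isExtreme_tight N⟩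

theorem FaceOf.mem_range_tightEmbedding [Finite ι] {N : Set ι} :
    OrderDual.toDual N ∈ Set.range (FaceOf.tightEmbedding (g := g) (r := r) (a := a) (b := b)) ↔
      ∃ x ∈ polyhedron g r a b, ∀ i, i ∈ N ↔ a i x = b i := by
  constructor
  · rintro ⟨F, hF⟩
    obtain ⟨x, hx, h⟩ := F.exists_generic
    have hN : F.tight = N := hF
    exact ⟨x, F.2.2.2.subset hx, fun i => Set.ext_iff.mp (hN.symm.trans h) i⟩
  · rintro ⟨x, hx, h⟩
    refine ⟨FaceOf.ofTight N ⟨x, hx, fun i => (h i).mp⟩, ?_⟩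
    refine congrArg OrderDual.toDual (Set.Subset.antisymm ?_ ?_)
    · exact fun i hi => (h i).mpr (hi x ⟨hx, fun i => (h i).mp⟩)
    · exact fun i hi y hy => hy.2 i hi

/-- Two polyhedra in which the same sets of inequalities are simultaneously tight have isomorphic
face posets. -/
theorem FaceOf.nonempty_orderIso_of_tight [Finite ι]
    (h : ∀ N : Set ι, (∃ x ∈ polyhedron g r a b, ∀ i, i ∈ N ↔ a i x = b i) ↔
      ∃ x ∈ polyhedron g' r' a' b', ∀ i, i ∈ N ↔ a' i x = b' i) :
    Nonempty (FaceOf (polyhedron g r a b) ≃o FaceOf (polyhedron g' r' a' b')) := by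
  have hr : Set.range (FaceOf.tightEmbedding (g := g) (r := r) (a := a) (b := b)) =
      Set.range (FaceOf.tightEmbedding (g := g') (r := r') (a := a') (b := b')) :=
    Set.ext fun N => FaceOf.mem_range_tightEmbedding.trans
      ((h (OrderDual.ofDual N)).trans FaceOf.mem_range_tightEmbedding.symm)
  exact ⟨(FaceOf.tightEmbedding.orderIso.trans (OrderIso.setCongr _ _ hr)).trans
    FaceOf.tightEmbedding.orderIso.symm⟩

end Polyhedron

/-! ### Deformed graph-associahedra -/

/-- The sum of the coordinates in `T`. -/
noncomputable def mass {V : Type} [Finite V] (T : Set V) : (V → ℝ) →ₗ[ℝ] ℝ where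
  toFun x := ∑ᶠ i ∈ T, x i
  map_add' _ _ := finsum_mem_add_distrib T.toFinite
  map_smul' r x := (mul_finsum_mem x r).symm

section Mass

variable {V : Type} [Finite V]

theorem mass_union {T U : Set V} (h : Disjoint T U) (x : V → ℝ) :
    mass (T ∪ U) x = mass T x + mass U x :=
  finsum_mem_union h T.toFinite U.toFinite

theorem mass_eq_diff_add {T U : Set V} (h : U ⊆ T) (x : V → ℝ) :
    mass T x = mass (T \ U) x + mass U x := by
  rw [← mass_union Set.disjoint_sdiff_left, Set.sdiff_union_of_subset h]

theorem mass_singleton (v : V) (x : V → ℝ) : mass {v} x = x v := finsum_mem_singleton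

theorem mass_image {W : Type} [Finite W] {f : W → V} (hf : Function.Injective f) (T : Set W)
    (x : V → ℝ) : mass (f '' T) x = mass T (x ∘ f) :=
  finsum_mem_image hf.injOn

theorem mass_nonneg {T : Set V} {x : V → ℝ} (h : ∀ v ∈ T, 0 ≤ x v) : 0 ≤ mass T x :=
  finsum_mem_induction (0 ≤ ·) le_rfl (fun _ _ => add_nonneg) h

end Mass

namespace SimpleGraph

variable {V : Type} {Γ : SimpleGraph V}

/-- The conditions on the right-hand sides `c` under which `x(T) ≥ c T`, for connected `T`, together
with `x(V) = c V`, define a polytope of the combinatorial type of the graph-associahedron. Besides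
`c T = 3 ^ |T|` they allow the right-hand sides which occur on the facets. -/
structure Admissible (Γ : SimpleGraph V) (c : Set V → ℝ) : Prop where
  nonneg : ∀ T, (Γ.induce T).Connected → 0 ≤ c T
  add_lt : ∀ A B, (Γ.induce A).Connected → (Γ.induce B).Connected → ¬A ⊆ B → ¬B ⊆ A →
    (Γ.induce (A ∪ B)).Connected → c A + c B < c (A ∪ B)

/-- The right-hand sides induced on a connected set `S`. -/
def restrictBound (c : Set V → ℝ) (S : Set V) : Set S → ℝ := fun T => c (Subtype.val '' T)

open scoped Classical in
/-- The right-hand sides induced on the contraction of `S` by the equation `x(S) = c S`. -/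
noncomputable def contractBound (Γ : SimpleGraph V) (c : Set V → ℝ) (S : Set V) :
    Set {v // v ∉ S} → ℝ := fun T =>
  if (Γ.induce (Subtype.val '' T ∪ S)).Connected then c (Subtype.val '' T ∪ S) - c S
  else c (Subtype.val '' T)

variable {c : Set V → ℝ} {S : Set V}

theorem contractBound_of_connected {T : Set {v // v ∉ S}}
    (h : (Γ.induce (Subtype.val '' T ∪ S)).Connected) :
    contractBound Γ c S T = c (Subtype.val '' T ∪ S) - c S := if_pos h

theorem contractBound_of_not_connected {T : Set {v // v ∉ S}}
    (h : ¬(Γ.induce (Subtype.val '' T ∪ S)).Connected) :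
    contractBound Γ c S T = c (Subtype.val '' T) := if_neg h

theorem not_mem_of_mem_val_image {T : Set {v // v ∉ S}} {v : V} (h : v ∈ Subtype.val '' T) :
    v ∉ S := by
  obtain ⟨w, -, rfl⟩ := h
  exact w.2

theorem val_image_subset_of_subset_union {A B : Set {v // v ∉ S}}
    (h : Subtype.val '' A ⊆ Subtype.val '' B ∪ S) : A ⊆ B :=
  (Set.image_subset_image_iff Subtype.val_injective).mp fun _ hv =>
    (h hv).resolve_right (not_mem_of_mem_val_image hv)

theorem val_image_diff (S T : Set V) :
    Subtype.val '' ({v | v.1 ∈ T} : Set {v // v ∉ S}) = T \ S := by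
  ext v
  simp [and_comm]

theorem val_image_inter (S T : Set V) :
    Subtype.val '' ({v | v.1 ∈ T} : Set S) = T ∩ S := by
  ext v
  simp [and_comm]

theorem Admissible.mono [Finite V] (hc : Γ.Admissible c) {A U : Set V}
    (hA : (Γ.induce A).Connected) (hU : (Γ.induce U).Connected) (hAU : A ⊆ U) : c A ≤ c U := by
  induction hn : (U \ A).ncard using Nat.strong_induction_on generalizing A with
  | _ n ih =>
    by_cases hUA : U ⊆ A
    · rw [Set.Subset.antisymm hAU hUA]
    obtain ⟨t, ht⟩ := (induce_connected_iff.mp hA).1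
    have : ∃ t ∈ A, ∃ v ∈ U, v ∉ A ∧ Γ.Adj t v := by
      by_contra! hcon
      exact hUA ((induce_connected_iff.mp hU).2 A ⟨t, ht, hAU ht⟩ fun x hx _ y hy hxy => by
        by_contra hyA
        exact hcon x hx y hy hyA hxy)
    obtain ⟨t, ht, v, hvU, hvA, htv⟩ := this
    have hAv := induce_union_connected_of_adj hA (induce_singleton_connected v) ht rfl htv
    have h1 := hc.add_lt A {v} hA (induce_singleton_connected v)
      (fun h => htv.ne (h ht)) (fun h => hvA (h rfl)) hAv
    have h2 := hc.nonneg {v} (induce_singleton_connected v)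
    have h3 := ih (U \ (A ∪ {v})).ncard (hn ▸ Set.ncard_lt_ncard
      ⟨Set.sdiff_subset_sdiff_right Set.subset_union_left,
        fun h => (h ⟨hvU, hvA⟩).2 (.inr rfl)⟩) hAv
      (Set.union_subset hAU (Set.singleton_subset_iff.mpr hvU)) rfl
    linarith

theorem Admissible.restrict (hc : Γ.Admissible c) (S : Set V) :
    (Γ.induce S).Admissible (restrictBound c S) where
  nonneg T hT := hc.nonneg _ (induce_induce_connected_iff.mp hT)
  add_lt A B hA hB hAB hBA h := by
    rw [induce_induce_connected_iff] at hA hB h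
    unfold restrictBound
    rw [Set.image_union] at h ⊢
    exact hc.add_lt _ _ hA hB
      (fun h => hAB ((Set.image_subset_image_iff Subtype.val_injective).mp h))
      (fun h => hBA ((Set.image_subset_image_iff Subtype.val_injective).mp h)) h

theorem Admissible.contract [Finite V] (hc : Γ.Admissible c) (hS : (Γ.induce S).Connected) :
    (Γ.contraction S).Admissible (contractBound Γ c S) where
  nonneg T hT := by
    obtain ⟨hne, h⟩ := (contraction_induce_connected_iff hS).mp hT
    by_cases hTS : (Γ.induce (Subtype.val '' T ∪ S)).Connected
    · rw [contractBound_of_connected hTS]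
      exact sub_nonneg.mpr (hc.mono hS hTS Set.subset_union_right)
    · rw [contractBound_of_not_connected hTS]
      exact hc.nonneg _ (h.resolve_right hTS)
  add_lt := by
    have hS0 := hc.nonneg S hS
    obtain ⟨s, hs⟩ := (induce_connected_iff.mp hS).1
    -- the union is joined to `S` as soon as one of the two sets is
    have hunion : ∀ A B : Set {v // v ∉ S}, ((Γ.contraction S).induce A).Connected →
        ((Γ.contraction S).induce (A ∪ B)).Connected →
        (Γ.induce (Subtype.val '' A ∪ S)).Connected →
        (Γ.induce (Subtype.val '' A ∪ Subtype.val '' B ∪ S)).Connected := by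
      intro A B hA hAB hAS
      obtain ⟨a, ha⟩ := (induce_connected_iff.mp hA).1
      have := ((contraction_induce_connected_iff hS).mp hAB).2
      rw [Set.image_union] at this
      refine this.elim (fun h => ?_) id
      have h2 := induce_union_connected_of_inter h hAS (t := a.1)
        (.inl ⟨a, ha, rfl⟩) (.inl ⟨a, ha, rfl⟩)
      rwa [← Set.union_assoc, Set.union_eq_self_of_subset_right Set.subset_union_left] at h2
    have hmixed : ∀ A B : Set {v // v ∉ S}, ((Γ.contraction S).induce A).Connected →
        ((Γ.contraction S).induce B).Connected → ¬B ⊆ A →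
        ((Γ.contraction S).induce (A ∪ B)).Connected →
        (Γ.induce (Subtype.val '' A ∪ S)).Connected →
        ¬(Γ.induce (Subtype.val '' B ∪ S)).Connected →
        contractBound Γ c S A + contractBound Γ c S B < contractBound Γ c S (A ∪ B) := by
      intro A B hA hB hBA hAB hAS hBS
      have hU := hunion A B hA hAB hAS
      have hB' := ((contraction_induce_connected_iff hS).mp hB).2.resolve_right hBS
      have := hc.add_lt (Subtype.val '' A ∪ S) (Subtype.val '' B) hAS hB'
        (fun h => not_mem_of_mem_val_image (h (.inr hs)) hs)
        (fun h => hBA (val_image_subset_of_subset_union h))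
      rw [Set.union_right_comm] at this
      have := this hU
      rw [← Set.image_union] at this hU
      rw [contractBound_of_connected hAS, contractBound_of_not_connected hBS,
        contractBound_of_connected hU]
      linarith
    intro A B hA hB hAB hBA hABc
    by_cases hAS : (Γ.induce (Subtype.val '' A ∪ S)).Connected <;>
      by_cases hBS : (Γ.induce (Subtype.val '' B ∪ S)).Connected
    · have hU := hunion A B hA hABc hAS
      have := hc.add_lt (Subtype.val '' A ∪ S) (Subtype.val '' B ∪ S) hAS hBS
        (fun h => hAB (val_image_subset_of_subset_union (Set.subset_union_left.trans h)))
        (fun h => hBA (val_image_subset_of_subset_union (Set.subset_union_left.trans h)))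
      rw [← Set.union_union_distrib_right] at this
      have := this hU
      rw [← Set.image_union] at this hU
      rw [contractBound_of_connected hAS, contractBound_of_connected hBS,
        contractBound_of_connected hU]
      linarith
    · exact hmixed A B hA hB hBA hABc hAS hBS
    · rw [Set.union_comm, add_comm]
      exact hmixed B A hB hA hAB (Set.union_comm A B ▸ hABc) hBS hAS
    · have hA' := ((contraction_induce_connected_iff hS).mp hA).2.resolve_right hAS
      have hB' := ((contraction_induce_connected_iff hS).mp hB).2.resolve_right hBS
      -- no edge joins `A ∪ B` to `S`
      have hU : ¬(Γ.induce (Subtype.val '' (A ∪ B) ∪ S)).Connected := by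
        intro hU
        have hsub := (induce_connected_iff.mp hU).2 S ⟨s, hs, .inr hs⟩ (by
          intro x hx _ y hy hxy
          rw [Set.image_union] at hy
          rcases hy with (hy | hy) | hy
          · exact (hAS (induce_union_connected_of_adj hA' hS hy hx hxy.symm)).elim
          · exact (hBS (induce_union_connected_of_adj hB' hS hy hx hxy.symm)).elim
          · exact hy)
        obtain ⟨a, ha⟩ := (induce_connected_iff.mp hA).1
        exact a.2 (hsub (.inl ⟨a, .inl ha, rfl⟩))
      have hABΓ := ((contraction_induce_connected_iff hS).mp hABc).2.resolve_right hU
      rw [contractBound_of_not_connected hAS, contractBound_of_not_connected hBS,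
        contractBound_of_not_connected hU]
      rw [Set.image_union] at hABΓ ⊢
      exact hc.add_lt _ _ hA' hB'
        (fun h => hAB ((Set.image_subset_image_iff Subtype.val_injective).mp h))
        (fun h => hBA ((Set.image_subset_image_iff Subtype.val_injective).mp h)) hABΓ

variable [Finite V]

/-- The polytope of all `x` with `x(V) = c V` and `x(T) ≥ c T` for all connected sets `T` of
vertices. The case `T = V`, which the equation implies for connected graphs, is included. -/
def tubePolytope (Γ : SimpleGraph V) (c : Set V → ℝ) : Set (V → ℝ) :=
  polyhedron (mass Set.univ) (c Set.univ)
    (fun T : {T : Set V // (Γ.induce T).Connected} => mass T.1) fun T => c T.1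

theorem mem_tubePolytope {x : V → ℝ} : x ∈ Γ.tubePolytope c ↔
    mass Set.univ x = c Set.univ ∧ ∀ T, (Γ.induce T).Connected → c T ≤ mass T x :=
  and_congr_right fun _ => Subtype.forall

theorem nonneg_of_mem_tubePolytope (hc : Γ.Admissible c) {x : V → ℝ} (hx : x ∈ Γ.tubePolytope c)
    (v : V) : 0 ≤ x v := by
  have h := (mem_tubePolytope.mp hx).2 {v} (induce_singleton_connected v)
  rw [mass_singleton] at h
  exact (hc.nonneg _ (induce_singleton_connected v)).trans h

/-- The inequalities of two incomparable connected sets with connected union are never tight at the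
same time. -/
theorem not_tight_of_incomparable (hc : Γ.Admissible c) {x : V → ℝ} (hx : x ∈ Γ.tubePolytope c)
    {A B : Set V} (hA : (Γ.induce A).Connected) (hB : (Γ.induce B).Connected) (hAB : ¬A ⊆ B)
    (hBA : ¬B ⊆ A) (h : (Γ.induce (A ∪ B)).Connected) (hxA : mass A x = c A) :
    mass B x ≠ c B := by
  intro hxB
  have h1 := hc.add_lt A B hA hB hAB hBA h
  have h2 := (mem_tubePolytope.mp hx).2 _ h
  have h3 : mass (A ∪ B) x = mass (A \ B) x + mass B x := by
    rw [← mass_union Set.disjoint_sdiff_left, Set.sdiff_union_self]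
  have h4 : mass A x = mass (A \ B) x + mass (A ∩ B) x := by
    rw [← mass_union Set.disjoint_sdiff_inter, Set.sdiff_union_inter]
  have h5 : 0 ≤ mass (A ∩ B) x := mass_nonneg fun v _ => nonneg_of_mem_tubePolytope hc hx v
  linarith

/-- Combines coordinates on `S` and on the complement of `S`. -/
noncomputable def splitCoord (S : Set V) :
    (V → ℝ) ≃ₗ[ℝ] (S → ℝ) × ({v // v ∉ S} → ℝ) where
  toFun x := (fun v => x v.1, fun v => x v.1)
  map_add' _ _ := rfl
  map_smul' _ _ := rfl
  invFun p := by
    classical exact fun v => if h : v ∈ S then p.1 ⟨v, h⟩ else p.2 ⟨v, h⟩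
  left_inv x := by
    ext v
    by_cases h : v ∈ S <;> simp [h]
  right_inv p := by
    refine Prod.ext (funext fun v => ?_) (funext fun v => ?_)
    · simp
    · simp [v.2]

theorem mass_val_image (S : Set V) (T : Set S) (x : V → ℝ) :
    mass (Subtype.val '' T) x = mass T (splitCoord S x).1 :=
  mass_image Subtype.val_injective T x

theorem mass_val_image_compl (S : Set V) (T : Set {v // v ∉ S}) (x : V → ℝ) :
    mass (Subtype.val '' T) x = mass T (splitCoord S x).2 :=
  mass_image Subtype.val_injective T x

theorem mass_val_image_union (S : Set V) (T : Set {v // v ∉ S}) (x : V → ℝ) :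
    mass (Subtype.val '' T ∪ S) x = mass T (splitCoord S x).2 + mass S x := by
  rw [mass_union (Set.disjoint_left.mpr fun _ => not_mem_of_mem_val_image), mass_val_image_compl]

/-- The facet `x(S) = c S` is a product: the coordinates in `S` and those outside range over the
polytopes of the restriction to `S` and of the contraction of `S`. -/
theorem mem_facet_iff (hΓ : Γ.Connected) (hc : Γ.Admissible c) (hS : (Γ.induce S).Connected)
    {x : V → ℝ} : (x ∈ Γ.tubePolytope c ∧ mass S x = c S) ↔
      (splitCoord S x).1 ∈ (Γ.induce S).tubePolytope (restrictBound c S) ∧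
      (splitCoord S x).2 ∈ (Γ.contraction S).tubePolytope (contractBound Γ c S) := by
  have hV := induce_univ_connected_iff.mpr hΓ
  have hmS : mass Set.univ (splitCoord S x).1 = mass S x := by
    rw [← mass_val_image, Subtype.coe_image_univ]
  have hcS : restrictBound c S Set.univ = c S := by
    unfold restrictBound
    rw [Subtype.coe_image_univ]
  have hmV : mass Set.univ x = mass Set.univ (splitCoord S x).2 + mass S x := by
    rw [← mass_val_image_union, val_image_univ_union]
  have hcV : contractBound Γ c S Set.univ = c Set.univ - c S := by
    rw [contractBound_of_connected] <;> rw [val_image_univ_union]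
    exact hV
  constructor
  · rintro ⟨hx, hxS⟩
    refine ⟨mem_tubePolytope.mpr ⟨?_, fun T hT => ?_⟩, mem_tubePolytope.mpr ⟨?_, fun T hT => ?_⟩⟩
    · rw [hmS, hcS, hxS]
    · rw [← mass_val_image]
      exact (mem_tubePolytope.mp hx).2 _ (induce_induce_connected_iff.mp hT)
    · have := (mem_tubePolytope.mp hx).1
      rw [hcV]
      linarith
    · by_cases hTS : (Γ.induce (Subtype.val '' T ∪ S)).Connected
      · have := (mem_tubePolytope.mp hx).2 _ hTS
        rw [mass_val_image_union] at this
        rw [contractBound_of_connected hTS]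
        linarith
      · rw [contractBound_of_not_connected hTS, ← mass_val_image_compl]
        exact (mem_tubePolytope.mp hx).2 _
          (((contraction_induce_connected_iff hS).mp hT).2.resolve_right hTS)
  · rintro ⟨h1, h2⟩
    have hxS : mass S x = c S := by
      rw [← hmS, ← hcS]
      exact (mem_tubePolytope.mp h1).1
    refine ⟨mem_tubePolytope.mpr ⟨?_, fun T hT => ?_⟩, hxS⟩
    · rw [hmV, (mem_tubePolytope.mp h2).1, hcV, hxS]
      ring
    by_cases hTS : T ⊆ S
    · have hTi := val_image_inter S T
      rw [Set.inter_eq_left.mpr hTS] at hTi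
      have := (mem_tubePolytope.mp h1).2 {v | v.1 ∈ T}
        (by rwa [induce_induce_connected_iff, hTi])
      rw [← mass_val_image, hTi, restrictBound, hTi] at this
      exact this
    obtain ⟨t, htT, htS⟩ := Set.not_subset.mp hTS
    obtain ⟨s, hs⟩ := (induce_connected_iff.mp hS).1
    have hTd := val_image_diff S T
    by_cases hdis : ∃ v ∈ T, v ∈ S
    · obtain ⟨v, hvT, hvS⟩ := hdis
      have hU := induce_union_connected_of_inter hT hS hvT hvS
      have hTdS : Subtype.val '' ({v | v.1 ∈ T} : Set {v // v ∉ S}) ∪ S = T ∪ S := by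
        rw [hTd, Set.sdiff_union_self]
      have := (mem_tubePolytope.mp h2).2 {v | v.1 ∈ T} (by
        rw [contraction_induce_connected_iff hS, hTdS]
        exact ⟨⟨⟨t, htS⟩, htT⟩, .inr hU⟩)
      rw [contractBound_of_connected (hTdS.symm ▸ hU), hTdS, ← mass_val_image_compl, hTd] at this
      by_cases hST : S ⊆ T
      · rw [Set.union_eq_self_of_subset_right hST] at this
        rw [mass_eq_diff_add hST]
        linarith
      · have hlt := hc.add_lt T S hT hS hTS hST hU
        have h4 : mass T x = mass (T \ S) x + mass (T ∩ S) x := by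
          rw [← mass_union Set.disjoint_sdiff_inter, Set.sdiff_union_inter]
        have h5 : 0 ≤ mass (T ∩ S) x := mass_nonneg fun v hv =>
          nonneg_of_mem_tubePolytope (hc.restrict S) h1 ⟨v, hv.2⟩
        linarith
    · push Not at hdis
      have hTeq : T \ S = T := sdiff_eq_left.mpr (Set.disjoint_left.mpr hdis)
      rw [hTeq] at hTd
      have := (mem_tubePolytope.mp h2).2 {v | v.1 ∈ T} (by
        rw [contraction_induce_connected_iff hS, hTd]
        exact ⟨⟨⟨t, htS⟩, htT⟩, .inl hT⟩)
      rw [← mass_val_image_compl, hTd] at this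
      refine le_trans ?_ this
      by_cases hU : (Γ.induce (T ∪ S)).Connected
      · rw [contractBound_of_connected (hTd.symm ▸ hU), hTd]
        have := hc.add_lt T S hT hS hTS (fun h => hdis s (h hs) hs) hU
        linarith
      · rw [contractBound_of_not_connected (hTd.symm ▸ hU), hTd]

end SimpleGraph

/-! ### The combinatorial type does not depend on the right-hand sides -/

namespace SimpleGraph

theorem card_coe_lt {V : Type} [Finite V] {S : Set V} (hne : S ≠ Set.univ) :
    Nat.card S < Nat.card V := by
  rw [Nat.card_coe_set_eq, ← Set.ncard_univ]
  exact Set.ncard_lt_ncard (Set.ssubset_univ_iff.mpr hne)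

theorem card_notMem_lt {V : Type} [Finite V] {S : Set V} (h : S.Nonempty) :
    Nat.card {v // v ∉ S} < Nat.card V :=
  card_coe_lt (S := Sᶜ) fun hS => by
    obtain ⟨v, hv⟩ := h
    exact (hS.symm.subset (Set.mem_univ v)) hv

section Iso

variable {V W : Type} {Γ : SimpleGraph V} {Λ : SimpleGraph W}

theorem Iso.induce_image_connected_iff (e : Γ ≃g Λ) {T : Set V} :
    (Λ.induce (e '' T)).Connected ↔ (Γ.induce T).Connected := by
  rw [induce_connected_iff, induce_connected_iff, Set.image_nonempty]
  refine and_congr_right fun _ => ⟨fun h A hA hcl => ?_, fun h A hA hcl => ?_⟩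
  · obtain ⟨x, hx, hxT⟩ := hA
    refine (Set.image_subset_image_iff e.injective).mp
      (h (e '' A) ⟨e x, ⟨x, hx, rfl⟩, x, hxT, rfl⟩ ?_)
    rintro _ ⟨x, hx, rfl⟩ ⟨x', hxT, hx'⟩ _ ⟨y, hy, rfl⟩ hxy
    obtain rfl := e.injective hx'
    exact ⟨y, hcl _ hx hxT y hy (e.map_adj_iff.mp hxy), rfl⟩
  · obtain ⟨_, hx, x, hxT, rfl⟩ := hA
    exact Set.image_subset_iff.mpr (h (e ⁻¹' A) ⟨x, hx, hxT⟩ fun x hx hxT y hy hxy =>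
      hcl _ hx ⟨x, hxT, rfl⟩ _ ⟨y, hy, rfl⟩ (e.map_adj_iff.mpr hxy))

/-- Right-hand sides transported along a graph isomorphism. -/
theorem Admissible.comap (e : Γ ≃g Λ) {c : Set W → ℝ} (hc : Λ.Admissible c) :
    Γ.Admissible fun T => c (e '' T) where
  nonneg T hT := hc.nonneg _ (e.induce_image_connected_iff.mpr hT)
  add_lt A B hA hB hAB hBA h := by
    have h' := e.induce_image_connected_iff.mpr h
    rw [Set.image_union] at h' ⊢
    exact hc.add_lt _ _ (e.induce_image_connected_iff.mpr hA) (e.induce_image_connected_iff.mpr hB)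
      (fun h => hAB ((Set.image_subset_image_iff e.injective).mp h))
      (fun h => hBA ((Set.image_subset_image_iff e.injective).mp h)) h'

end Iso

variable {V : Type} [Finite V] {Γ : SimpleGraph V} {c : Set V → ℝ}

theorem convex_tubePolytope : Convex ℝ (Γ.tubePolytope c) := convex_polyhedron

/-- A point of the polytope at which no inequality of a proper connected set is tight. It exists
since the inequality of `T` is not tight on the (nonempty) facet of a neighbour of `T`. -/
theorem exists_interior (hΓ : Γ.Connected) (hc : Γ.Admissible c) : ∃ x ∈ Γ.tubePolytope c,
    ∀ T, (Γ.induce T).Connected → T ≠ Set.univ → mass T x ≠ c T := by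
  induction hn : Nat.card V using Nat.strong_induction_on generalizing V with
  | _ n ih =>
    subst hn
    by_cases hsub : Subsingleton V
    · have hT : ∀ T : Set V, (Γ.induce T).Connected → T = Set.univ := fun T hT =>
        Subsingleton.eq_univ_of_nonempty (induce_connected_iff.mp hT).1
      obtain ⟨v⟩ := hΓ.nonempty
      have hv : Set.univ = {v} := (hT _ (induce_singleton_connected v)).symm
      have hm : mass Set.univ (fun _ => c Set.univ : V → ℝ) = c Set.univ := by
        rw [hv, mass_singleton]
      exact ⟨fun _ => c Set.univ, mem_tubePolytope.mpr ⟨hm, fun T h => by rw [hT T h, hm]⟩,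
        fun T h hne => (hne (hT T h)).elim⟩
    · have hfacet : ∀ v, ∃ x ∈ Γ.tubePolytope c, mass {v} x = c {v} := by
        intro v
        have hv := induce_singleton_connected (Γ := Γ) v
        have hne : {v} ≠ (Set.univ : Set V) := fun h =>
          hsub (Set.subsingleton_univ_iff.mp (h ▸ Set.subsingleton_singleton))
        obtain ⟨y, hy, -⟩ := ih _ (card_coe_lt hne) hv (hc.restrict {v}) rfl
        obtain ⟨z, hz, -⟩ := ih _ (card_notMem_lt (Set.singleton_nonempty v))
          (contraction_connected hΓ hv hne) (hc.contract hv) rfl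
        exact ⟨(splitCoord {v}).symm (y, z), (mem_facet_iff hΓ hc hv).mpr
          (by rw [LinearEquiv.apply_symm_apply]; exact ⟨hy, hz⟩)⟩
      obtain ⟨x₀, hx₀, -⟩ := hfacet hΓ.nonempty.some
      obtain ⟨x, hx, hmin⟩ := convex_tubePolytope.exists_generic ⟨x₀, hx₀⟩
        (fun T : {T : Set V // (Γ.induce T).Connected} => mass T.1) (fun T => c T.1)
        fun x hx => hx.2
      refine ⟨x, hx, fun T hT hne hxT => ?_⟩
      obtain ⟨t, ht, v, hv, htv⟩ := hΓ.exists_adj_of_ne_univ (induce_connected_iff.mp hT).1 hne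
      obtain ⟨z, hz, hzv⟩ := hfacet v
      exact not_tight_of_incomparable hc hz hT (induce_singleton_connected v)
        (fun h => htv.ne (h ht)) (fun h => hv (h rfl))
        (induce_union_connected_of_adj hT (induce_singleton_connected v) ht rfl htv)
        (hmin ⟨T, hT⟩ hxT z hz) hzv

/-- On the facet of `S`, the tight inequalities are determined by those that are tight in the two
factors, in a way that does not depend on the right-hand sides. -/
theorem tight_of_tight_factors {S : Set V} (hS : (Γ.induce S).Connected) {c' : Set V → ℝ}
    (hc : Γ.Admissible c) {x y : V → ℝ} (hx : x ∈ Γ.tubePolytope c) (hxS : mass S x = c S)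
    (hyS : mass S y = c' S)
    (h1 : ∀ T, ((Γ.induce S).induce T).Connected →
      mass T (splitCoord S x).1 = restrictBound c S T →
      mass T (splitCoord S y).1 = restrictBound c' S T)
    (h2 : ∀ T, ((Γ.contraction S).induce T).Connected →
      mass T (splitCoord S x).2 = contractBound Γ c S T →
      mass T (splitCoord S y).2 = contractBound Γ c' S T)
    {T : Set V} (hT : (Γ.induce T).Connected) (hxT : mass T x = c T) : mass T y = c' T := by
  by_cases hTS : T ⊆ S
  · have hTi := val_image_inter S T
    rw [Set.inter_eq_left.mpr hTS] at hTi
    have := h1 {v | v.1 ∈ T} (by rwa [induce_induce_connected_iff, hTi])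
      (by rw [← mass_val_image, restrictBound, hTi, hxT])
    rwa [← mass_val_image, restrictBound, hTi] at this
  obtain ⟨t, htT, htS⟩ := Set.not_subset.mp hTS
  obtain ⟨s, hs⟩ := (induce_connected_iff.mp hS).1
  have hTd := val_image_diff S T
  by_cases hST : S ⊆ T
  · have hTU : Subtype.val '' ({v | v.1 ∈ T} : Set {v // v ∉ S}) ∪ S = T := by
      rw [hTd, Set.sdiff_union_of_subset hST]
    have hconn : (Γ.induce (Subtype.val '' ({v | v.1 ∈ T} : Set {v // v ∉ S}) ∪ S)).Connected := by
      rwa [hTU]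
    have := h2 {v | v.1 ∈ T}
      ((contraction_induce_connected_iff hS).mpr ⟨⟨⟨t, htS⟩, htT⟩, .inr hconn⟩) (by
        have := mass_val_image_union S {v | v.1 ∈ T} x
        rw [contractBound_of_connected hconn, hTU]
        rw [hTU] at this
        linarith)
    have h3 := mass_val_image_union S {v | v.1 ∈ T} y
    rw [contractBound_of_connected hconn, hTU] at this
    rw [hTU] at h3
    linarith
  by_cases hU : (Γ.induce (T ∪ S)).Connected
  · exact absurd hxS (not_tight_of_incomparable hc hx hT hS hTS hST hU hxT)
  have hdis : ∀ v ∈ T, v ∉ S := fun v hvT hvS =>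
    hU (induce_union_connected_of_inter hT hS hvT hvS)
  rw [sdiff_eq_left.mpr (Set.disjoint_left.mpr hdis)] at hTd
  have hconn : ¬(Γ.induce (Subtype.val '' ({v | v.1 ∈ T} : Set {v // v ∉ S}) ∪ S)).Connected := by
    rwa [hTd]
  have := h2 {v | v.1 ∈ T} ((contraction_induce_connected_iff hS).mpr
    ⟨⟨⟨t, htS⟩, htT⟩, .inl (by rwa [hTd])⟩) (by
      rw [contractBound_of_not_connected hconn, ← mass_val_image_compl, hTd, hxT])
  rwa [contractBound_of_not_connected hconn, ← mass_val_image_compl, hTd] at this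

/-- The sets of inequalities that are simultaneously tight do not depend on the right-hand sides. -/
theorem exists_same_tight (hΓ : Γ.Connected) {c' : Set V → ℝ} (hc : Γ.Admissible c)
    (hc' : Γ.Admissible c') {x : V → ℝ} (hx : x ∈ Γ.tubePolytope c) :
    ∃ y ∈ Γ.tubePolytope c', ∀ T, (Γ.induce T).Connected → (mass T x = c T ↔ mass T y = c' T) := by
  induction hn : Nat.card V using Nat.strong_induction_on generalizing V with
  | _ n ih =>
    subst hn
    by_cases hex : ∃ S, (Γ.induce S).Connected ∧ S ≠ Set.univ ∧ mass S x = c S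
    · obtain ⟨S, hS, hne, hxS⟩ := hex
      obtain ⟨hx1, hx2⟩ := (mem_facet_iff hΓ hc hS).mp ⟨hx, hxS⟩
      obtain ⟨y, hy, hxy⟩ := ih _ (card_coe_lt hne) hS (hc.restrict S) (hc'.restrict S) hx1 rfl
      obtain ⟨z, hz, hxz⟩ := ih _ (card_notMem_lt (induce_connected_iff.mp hS).1)
        (contraction_connected hΓ hS hne) (hc.contract hS) (hc'.contract hS) hx2 rfl
      have hw : splitCoord S ((splitCoord S).symm (y, z)) = (y, z) :=
        LinearEquiv.apply_symm_apply _ _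
      generalize (splitCoord S).symm (y, z) = w at hw
      have hw1 : (splitCoord S w).1 = y := congrArg Prod.fst hw
      have hw2 : (splitCoord S w).2 = z := congrArg Prod.snd hw
      subst hw1 hw2
      obtain ⟨hwm, hwS⟩ := (mem_facet_iff hΓ hc' hS).mpr ⟨hy, hz⟩
      exact ⟨w, hwm, fun T hT =>
        ⟨tight_of_tight_factors hS hc hx hxS hwS (fun T hT => (hxy T hT).mp)
          (fun T hT => (hxz T hT).mp) hT,
        tight_of_tight_factors hS hc' hwm hwS hxS (fun T hT => (hxy T hT).mpr)
          (fun T hT => (hxz T hT).mpr) hT⟩⟩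
    · push Not at hex
      obtain ⟨y, hy, hyt⟩ := exists_interior hΓ hc'
      refine ⟨y, hy, fun T hT => ?_⟩
      by_cases hTu : T = Set.univ
      · subst hTu
        exact iff_of_true (mem_tubePolytope.mp hx).1 (mem_tubePolytope.mp hy).1
      · exact iff_of_false (hex T hT hTu) (hyt T hT hTu)

/-- Polytopes of the same graph with different right-hand sides are combinatorially equivalent. -/
theorem nonempty_faceOf_orderIso (hΓ : Γ.Connected) {c' : Set V → ℝ} (hc : Γ.Admissible c)
    (hc' : Γ.Admissible c') :
    Nonempty (FaceOf (Γ.tubePolytope c) ≃o FaceOf (Γ.tubePolytope c')) := by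
  refine FaceOf.nonempty_orderIso_of_tight fun N => ⟨?_, ?_⟩
  · rintro ⟨x, hx, h⟩
    obtain ⟨y, hy, hxy⟩ := exists_same_tight hΓ hc hc' hx
    exact ⟨y, hy, fun T => (h T).trans (hxy T.1 T.2)⟩
  · rintro ⟨x, hx, h⟩
    obtain ⟨y, hy, hxy⟩ := exists_same_tight hΓ hc' hc hx
    exact ⟨y, hy, fun T => (h T).trans (hxy T.1 T.2)⟩

variable {W : Type} [Finite W] {Λ : SimpleGraph W}

theorem preimage_tubePolytope (e : Γ ≃g Λ) (c : Set W → ℝ) :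
    LinearEquiv.funCongrLeft ℝ ℝ e.toEquiv ⁻¹' Γ.tubePolytope (fun T => c (e '' T)) =
      Λ.tubePolytope c := by
  have hm : ∀ (T : Set V) (x : W → ℝ),
      mass T (LinearEquiv.funCongrLeft ℝ ℝ e.toEquiv x) = mass (e '' T) x :=
    fun T x => (mass_image e.injective T x).symm
  ext x
  rw [Set.mem_preimage, mem_tubePolytope, mem_tubePolytope, hm]
  have hu : e '' Set.univ = Set.univ := Set.image_univ_of_surjective e.surjective
  rw [hu]
  refine and_congr_right fun _ => ⟨fun h T hT => ?_, fun h T hT => ?_⟩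
  · obtain ⟨T, rfl⟩ : ∃ U, T = e '' U := ⟨e ⁻¹' T, (Set.image_preimage_eq T e.surjective).symm⟩
    have := h T (e.induce_image_connected_iff.mp hT)
    rwa [hm] at this
  · rw [hm]
    exact h _ (e.induce_image_connected_iff.mpr hT)

/-- Polytopes of isomorphic connected graphs are combinatorially equivalent. -/
theorem Iso.nonempty_faceOf_orderIso (e : Γ ≃g Λ) (hΓ : Γ.Connected) {c' : Set W → ℝ}
    (hc : Γ.Admissible c) (hc' : Λ.Admissible c') :
    Nonempty (FaceOf (Γ.tubePolytope c) ≃o FaceOf (Λ.tubePolytope c')) := by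
  obtain ⟨f⟩ := SimpleGraph.nonempty_faceOf_orderIso hΓ hc (hc'.comap e)
  have g := FaceOf.preimageIso (LinearEquiv.funCongrLeft ℝ ℝ e.toEquiv)
    (Γ.tubePolytope fun T => c' (e '' T))
  rw [preimage_tubePolytope] at g
  exact ⟨f.trans g.symm⟩

end SimpleGraph

/-! ### Facets of combinatorial types -/

namespace Polytope

/-- The elements below `a` and below its image under an order isomorphism. -/
def iicCongr {α β : Type} [Preorder α] [Preorder β] (e : α ≃o β) (a : α) :
    Set.Iic a ≃o Set.Iic (e a) where
  toFun x := ⟨e x.1, e.monotone x.2⟩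
  invFun x := ⟨e.symm x.1, by simpa using e.symm.monotone x.2⟩
  left_inv x := Subtype.ext (e.symm_apply_apply x.1)
  right_inv x := Subtype.ext (e.apply_symm_apply x.1)
  map_rel_iff' := e.le_iff_le

/-- The elements below a pair are the pairs of elements below its entries. -/
def iicProd {α β : Type} [Preorder α] [Preorder β] (a : α) (b : β) :
    Set.Iic (a, b) ≃o Set.Iic a × Set.Iic b where
  toFun x := (⟨x.1.1, x.2.1⟩, ⟨x.1.2, x.2.2⟩)
  invFun x := ⟨(x.1.1, x.2.1), x.1.2, x.2.2⟩
  left_inv _ := rfl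
  right_inv _ := rfl
  map_rel_iff' := Iff.rfl

theorem isCoatom_prod_iff {α β : Type} [PartialOrder α] [PartialOrder β] [OrderTop α] [OrderTop β]
    {a : α} {b : β} :
    IsCoatom (a, b) ↔ (IsCoatom a ∧ b = ⊤) ∨ (a = ⊤ ∧ IsCoatom b) := by
  constructor
  · intro h
    by_cases ha : a = ⊤
    · subst ha
      refine .inr ⟨rfl, fun hb => h.1 (Prod.ext rfl hb), fun c hc => ?_⟩
      exact congrArg Prod.snd (h.2 (⊤, c) (Prod.mk_lt_mk_iff_right.mpr hc))
    · have hb : b = ⊤ := by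
        by_contra hb
        have := h.2 (a, ⊤) (Prod.mk_lt_mk_iff_right.mpr (lt_top_iff_ne_top.mpr hb))
        exact ha (congrArg Prod.fst this)
      subst hb
      refine .inl ⟨⟨ha, fun c hc => ?_⟩, rfl⟩
      exact congrArg Prod.fst (h.2 (c, ⊤) (Prod.mk_lt_mk_iff_left.mpr hc))
  · rintro (⟨ha, rfl⟩ | ⟨rfl, hb⟩)
    · refine ⟨fun h => ha.1 (congrArg Prod.fst h), fun c hc => ?_⟩
      have h2 : c.2 = ⊤ := top_le_iff.mp hc.le.2
      have h1 : a < c.1 := lt_of_le_not_ge hc.le.1 fun h => hc.not_ge ⟨h, le_top⟩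
      exact Prod.ext (ha.2 _ h1) h2
    · refine ⟨fun h => hb.1 (congrArg Prod.snd h), fun c hc => ?_⟩
      have h2 : c.1 = ⊤ := top_le_iff.mp hc.le.1
      have h1 : b < c.2 := lt_of_le_not_ge hc.le.2 fun h => hc.not_ge ⟨le_top, h⟩
      exact Prod.ext h2 (hb.2 _ h1)

theorem toClass_eq_iff {P Q : Polytope} : P.toClass = Q.toClass ↔ Nonempty (P.Face ≃o Q.Face) :=
  Quotient.eq

theorem toClass_mul (P Q : Polytope) : P.toClass * Q.toClass = (P.prod Q).toClass := rfl

theorem toClass_surjective (X : Class) : ∃ P : Polytope, P.toClass = X := Quotient.exists_rep X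

theorem toClass_top (P : Polytope) : (⊤ : P.Face).toPolytope.toClass = P.toClass :=
  toClass_eq_iff.mpr ⟨OrderIso.refl _⟩

theorem toClass_face_congr {P Q : Polytope} (e : P.Face ≃o Q.Face) (F : P.Face) :
    F.toPolytope.toClass = (e F).toPolytope.toClass :=
  toClass_eq_iff.mpr ⟨(F.faceIso.trans (iicCongr e F)).trans (Face.faceIso _).symm⟩

theorem toClass_face_prod {P Q : Polytope} (F : (P.prod Q).Face) :
    F.toPolytope.toClass = (prodFaceIso P Q F).1.toPolytope.toClass *
      (prodFaceIso P Q F).2.toPolytope.toClass :=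
  toClass_eq_iff.mpr ⟨((F.faceIso.trans (iicCongr (prodFaceIso P Q) F)).trans
    ((iicProd _ _).trans (prodMap (Face.faceIso _).symm (Face.faceIso _).symm))).trans
      (prodFaceIso _ _).symm⟩

/-- The number of facets of a polytope. -/
noncomputable def numFacets (P : Polytope) : ℕ := Nat.card {F : P.Face // IsCoatom F}

namespace Class

/-- The number of facets of a combinatorial type. -/
noncomputable def numFacets : Class → ℕ :=
  Quotient.lift Polytope.numFacets fun _ _ ⟨e⟩ =>
    Nat.card_congr (e.toEquiv.subtypeEquiv fun F => (e.isCoatom_iff F).symm)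

/-- The number of nonempty faces of a combinatorial type. -/
noncomputable def numFaces : Class → ℕ :=
  Quotient.lift (fun P : Polytope => Nat.card P.Face) fun _ _ ⟨e⟩ => Nat.card_congr e.toEquiv

/-- `Y` is the combinatorial type of a facet of a polytope of type `X`. -/
def IsFacet (Y X : Class) : Prop :=
  ∃ (P : Polytope) (F : P.Face), P.toClass = X ∧ IsCoatom F ∧ F.toPolytope.toClass = Y

theorem isFacet_toClass {Y : Class} {P : Polytope} :
    IsFacet Y P.toClass ↔ ∃ F : P.Face, IsCoatom F ∧ F.toPolytope.toClass = Y := by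
  constructor
  · rintro ⟨Q, F, h, hF, rfl⟩
    obtain ⟨e⟩ := toClass_eq_iff.mp h
    exact ⟨e F, (e.isCoatom_iff F).mpr hF, (toClass_face_congr e F).symm⟩
  · rintro ⟨F, hF, h⟩
    exact ⟨P, F, rfl, hF, h⟩

/-- The facets of a product are the products of a facet of one factor with the other factor. -/
theorem isFacet_mul_iff {X Y Z : Class} : IsFacet Z (X * Y) ↔
    (∃ X', IsFacet X' X ∧ Z = X' * Y) ∨ ∃ Y', IsFacet Y' Y ∧ Z = X * Y' := by
  obtain ⟨P, rfl⟩ := toClass_surjective X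
  obtain ⟨Q, rfl⟩ := toClass_surjective Y
  rw [toClass_mul, isFacet_toClass]
  constructor
  · rintro ⟨F, hF, rfl⟩
    rw [← (prodFaceIso P Q).isCoatom_iff] at hF
    rw [toClass_face_prod]
    generalize prodFaceIso P Q F = G at hF
    obtain ⟨G, H⟩ := G
    rcases isCoatom_prod_iff.mp hF with ⟨hG, rfl⟩ | ⟨rfl, hH⟩
    · exact .inl ⟨_, isFacet_toClass.mpr ⟨G, hG, rfl⟩, by rw [toClass_top]⟩
    · exact .inr ⟨_, isFacet_toClass.mpr ⟨H, hH, rfl⟩, by rw [toClass_top]⟩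
  · have key : ∀ (G : P.Face) (H : Q.Face), IsCoatom (G, H) →
        ∃ F : (P.prod Q).Face, IsCoatom F ∧
          F.toPolytope.toClass = G.toPolytope.toClass * H.toPolytope.toClass := fun G H h =>
      ⟨(prodFaceIso P Q).symm (G, H), ((prodFaceIso P Q).symm.isCoatom_iff _).mpr h, by
        rw [toClass_face_prod, OrderIso.apply_symm_apply]⟩
    rintro (⟨X', hX', rfl⟩ | ⟨Y', hY', rfl⟩)
    · obtain ⟨G, hG, rfl⟩ := isFacet_toClass.mp hX'
      rw [← toClass_top Q]
      exact key G ⊤ (isCoatom_prod_iff.mpr (.inl ⟨hG, rfl⟩))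
    · obtain ⟨H, hH, rfl⟩ := isFacet_toClass.mp hY'
      rw [← toClass_top P]
      exact key ⊤ H (isCoatom_prod_iff.mpr (.inr ⟨rfl, hH⟩))

theorem numFacets_mul (X Y : Class) : numFacets (X * Y) = numFacets X + numFacets Y := by
  obtain ⟨P, rfl⟩ := toClass_surjective X
  obtain ⟨Q, rfl⟩ := toClass_surjective Y
  change Nat.card {F : (P.prod Q).Face // IsCoatom F} =
    Nat.card {F : P.Face // IsCoatom F} + Nat.card {F : Q.Face // IsCoatom F}
  rw [← Nat.card_sum, Nat.card_congr ((prodFaceIso P Q).toEquiv.subtypeEquiv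
    fun F => ((prodFaceIso P Q).isCoatom_iff F).symm)]
  refine (Nat.card_congr (Equiv.ofBijective (fun G => Sum.elim
    (fun F : {F : P.Face // IsCoatom F} => ⟨(F.1, ⊤), isCoatom_prod_iff.mpr (.inl ⟨F.2, rfl⟩)⟩)
    (fun F : {F : Q.Face // IsCoatom F} => ⟨(⊤, F.1), isCoatom_prod_iff.mpr (.inr ⟨rfl, F.2⟩)⟩) G)
    ⟨?_, ?_⟩)).symm
  · rintro (⟨F, hF⟩ | ⟨F, hF⟩) (⟨G, hG⟩ | ⟨G, hG⟩) h <;>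
      simp only [Sum.elim_inl, Sum.elim_inr, Subtype.mk.injEq, Prod.mk.injEq] at h
    · simp [h.1]
    · exact (hF.1 h.1).elim
    · exact (hF.1 h.2).elim
    · simp [h.2]
  · rintro ⟨⟨F, G⟩, h⟩
    rcases isCoatom_prod_iff.mp h with ⟨hF, rfl⟩ | ⟨rfl, hG⟩
    · exact ⟨.inl ⟨F, hF⟩, rfl⟩
    · exact ⟨.inr ⟨G, hG⟩, rfl⟩

theorem numFacets_one : numFacets 1 = 0 := by
  have := numFacets_mul 1 1
  rw [mul_one] at this
  omega

theorem numFaces_lt_of_isFacet {X Y : Class} (h : IsFacet Y X) : numFaces Y < numFaces X := by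
  obtain ⟨P, F, rfl, hF, rfl⟩ := h
  change Nat.card F.toPolytope.Face < Nat.card P.Face
  rw [Nat.card_congr F.faceIso.toEquiv]
  exact SimpleGraph.card_coe_lt fun h => hF.1 (top_le_iff.mp (h.symm.subset (Set.mem_univ ⊤)))

theorem eq_one_or_exists_isFacet (X : Class) : X = 1 ∨ ∃ Y, IsFacet Y X := by
  obtain ⟨P, rfl⟩ := toClass_surjective X
  by_cases h : ∃ F : P.Face, F ≠ ⊤
  · obtain ⟨F, hF⟩ := h
    obtain ⟨G, hG, -⟩ := (IsCoatomic.eq_top_or_exists_le_coatom F).resolve_left hF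
    exact .inr ⟨_, isFacet_toClass.mpr ⟨G, hG, rfl⟩⟩
  · push Not at h
    refine .inl (toClass_eq_iff.mpr ⟨?_⟩)
    exact
      { toFun := fun _ => ⊤
        invFun := fun _ => ⊤
        left_inv := fun F => (h F).symm
        right_inv := fun F => Subsingleton.elim _ _
        map_rel_iff' := fun {F G} => by simp [h F, h G] }

/-- In a set of combinatorial types which is closed under passing to facets, the factors of a
product in the set belong to the set: pass to a vertex of the other factor. -/
theorem mem_of_mul_mem {M : Set Class} (hM : ∀ X ∈ M, ∀ Y, IsFacet Y X → Y ∈ M) {X Y : Class}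
    (h : X * Y ∈ M) : X ∈ M := by
  induction hn : numFaces Y using Nat.strong_induction_on generalizing Y with
  | _ n ih =>
    rcases eq_one_or_exists_isFacet Y with rfl | ⟨Z, hZ⟩
    · rwa [mul_one] at h
    · exact ih _ (hn ▸ numFaces_lt_of_isFacet hZ)
        (hM _ h _ (isFacet_mul_iff.mpr (.inr ⟨Z, hZ, rfl⟩))) rfl

/-- If all facets of the generators of a monoid of combinatorial types belong to the monoid, then so
do all facets of its elements. -/
theorem isFacet_mem_closure {s : Set Class}
    (hs : ∀ X ∈ s, ∀ Y, IsFacet Y X → Y ∈ Submonoid.closure s) {X : Class}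
    (hX : X ∈ Submonoid.closure s) {Y : Class} (hY : IsFacet Y X) : Y ∈ Submonoid.closure s := by
  induction hX using Submonoid.closure_induction generalizing Y with
  | mem X hX => exact hs X hX Y hY
  | one =>
    obtain ⟨F, hF, -⟩ := isFacet_toClass.mp (show IsFacet Y point.toClass from hY)
    exact (hF.1 (Subsingleton.elim _ _)).elim
  | mul X X' hX hX' ih ih' =>
    rcases isFacet_mul_iff.mp hY with ⟨Z, hZ, rfl⟩ | ⟨Z, hZ, rfl⟩
    · exact mul_mem (ih hZ) hX'
    · exact mul_mem hX (ih' hZ)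

end Class

/-! ### Subrings generated by polytopes -/

theorem d_toRing (P : Polytope) : d P.toRing = P.boundary :=
  FreeAbelianGroup.lift_apply_of _ _

/-- The subring generated by a set of polytopes is spanned by the monoid they generate. -/
theorem mem_subring_closure_iff {s : Set Class} {x : PRing} :
    x ∈ Subring.closure (FreeAbelianGroup.of '' s : Set PRing) ↔
      x ∈ AddSubgroup.closure
        (FreeAbelianGroup.of '' (Submonoid.closure s : Set Class) : Set PRing) := by
  rw [Subring.mem_closure_iff]
  have := MonoidHom.map_mclosure (FreeAbelianGroup.ofMulHom (α := Class)) s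
  rw [FreeAbelianGroup.ofMulHom_coe] at this
  rw [← this, Submonoid.coe_map, FreeAbelianGroup.ofMulHom_coe]

/-- A sum of polytopes lies in the subring generated by some polytopes only if each summand is a
product of generators, since the sum has no cancellation. -/
theorem boundary_mem_iff {s : Set Class} {P : Polytope} :
    P.boundary ∈ Subring.closure (FreeAbelianGroup.of '' s : Set PRing) ↔
      ∀ F : P.Face, IsCoatom F → F.toPolytope.toClass ∈ Submonoid.closure s := by
  classical
  rw [mem_subring_closure_iff]
  constructor
  · intro h F hF
    -- counts the summands outside the monoid
    let φ : PRing →+ ℤ :=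
      FreeAbelianGroup.lift fun X => if X ∈ Submonoid.closure s then 0 else 1
    have h0 : φ P.boundary = 0 := by
      have hle : AddSubgroup.closure
          (FreeAbelianGroup.of '' (Submonoid.closure s : Set Class) : Set PRing) ≤ φ.ker := by
        rw [AddSubgroup.closure_le]
        rintro _ ⟨X, hX, rfl⟩
        exact (FreeAbelianGroup.lift_apply_of _ _).trans (if_pos hX)
      exact hle h
    have := Fintype.ofFinite {F : P.Face // IsCoatom F}
    rw [boundary, finsum_eq_sum_of_fintype, map_sum] at h0
    have h1 : ∀ G : {F : P.Face // IsCoatom F}, φ G.1.toPolytope.toRing =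
        if G.1.toPolytope.toClass ∈ Submonoid.closure s then 0 else 1 :=
      fun G => FreeAbelianGroup.lift_apply_of _ _
    have h2 := (Finset.sum_eq_zero_iff_of_nonneg fun G _ => by
      rw [h1]; split_ifs <;> norm_num).mp h0 ⟨F, hF⟩ (Finset.mem_univ _)
    rw [h1] at h2
    by_contra hn
    rw [if_neg hn] at h2
    exact one_ne_zero h2
  · intro h
    refine finsum_induction (· ∈ AddSubgroup.closure _) (zero_mem _) (fun _ _ => add_mem) ?_
    exact fun F => AddSubgroup.subset_closure ⟨_, h F.1 F.2, rfl⟩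

/-- The subring generated by a set of polytopes is closed under `d` if and only if the facets of
every generator are products of generators. -/
theorem subring_closed_iff {s : Set Class} :
    (∀ x ∈ Subring.closure (FreeAbelianGroup.of '' s : Set PRing),
      d x ∈ Subring.closure (FreeAbelianGroup.of '' s : Set PRing)) ↔
      ∀ X ∈ s, ∀ Y, Class.IsFacet Y X → Y ∈ Submonoid.closure s := by
  constructor
  · intro h X hX Y hY
    obtain ⟨P, rfl⟩ := toClass_surjective X
    obtain ⟨F, hF, rfl⟩ := Class.isFacet_toClass.mp hY
    have := h P.toRing (Subring.subset_closure ⟨_, hX, rfl⟩)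
    rw [d_toRing, boundary_mem_iff] at this
    exact this F hF
  · intro h x hx
    rw [mem_subring_closure_iff] at hx
    induction hx using AddSubgroup.closure_induction with
    | mem x hx =>
      obtain ⟨X, hX, rfl⟩ := hx
      obtain ⟨P, rfl⟩ := toClass_surjective X
      change d P.toRing ∈ _
      rw [d_toRing, boundary_mem_iff]
      exact fun F hF => Class.isFacet_mem_closure h hX (Class.isFacet_toClass.mpr ⟨F, hF, rfl⟩)
    | zero => simp
    | add x y _ _ hx hy => rw [map_add]; exact add_mem hx hy
    | neg x _ hx => rw [map_neg]; exact neg_mem hx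

end Polytope

/-! ### Facets of graph-associahedra -/

namespace SimpleGraph

/-- The right-hand sides `3 ^ |T|` of the graph-associahedron. -/
noncomputable def powBound {V : Type} (T : Set V) : ℝ := 3 ^ T.ncard

theorem admissible_powBound {V : Type} [Finite V] (Γ : SimpleGraph V) :
    Γ.Admissible powBound where
  nonneg _ _ := by unfold powBound; positivity
  add_lt A B _ _ hAB hBA _ := by
    have hA : A.ncard < (A ∪ B).ncard := Set.ncard_lt_ncard
      ⟨Set.subset_union_left, fun h => hBA (Set.subset_union_right.trans h)⟩
    have hB : B.ncard < (A ∪ B).ncard := Set.ncard_lt_ncard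
      ⟨Set.subset_union_right, fun h => hAB (Set.subset_union_left.trans h)⟩
    unfold powBound
    obtain ⟨n, hn⟩ := Nat.exists_eq_succ_of_ne_zero (Nat.ne_of_gt (Nat.zero_lt_of_lt hA))
    rw [hn] at hA hB ⊢
    have h1 : (3 : ℝ) ^ A.ncard ≤ 3 ^ n := pow_le_pow_right₀ (by norm_num) (by omega)
    have h2 : (3 : ℝ) ^ B.ncard ≤ 3 ^ n := pow_le_pow_right₀ (by norm_num) (by omega)
    have h3 : (0 : ℝ) < 3 ^ n := by positivity
    rw [pow_succ]
    linarith

section General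

variable {V : Type} [Finite V] {Γ : SimpleGraph V} {c : Set V → ℝ} {S : Set V}

/-- The facet of a proper connected set `S` has a point at which no inequality is tight but that of
`S`. -/
theorem exists_generic_on_facet (hΓ : Γ.Connected) (hc : Γ.Admissible c)
    (hS : (Γ.induce S).Connected) (hne : S ≠ Set.univ) :
    ∃ x ∈ Γ.tubePolytope c, mass S x = c S ∧
      ∀ T, (Γ.induce T).Connected → T ≠ Set.univ → mass T x = c T → T = S := by
  obtain ⟨y, hy, hyt⟩ := exists_interior hS (hc.restrict S)
  obtain ⟨z, hz, hzt⟩ := exists_interior (contraction_connected hΓ hS hne) (hc.contract hS)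
  have hx : splitCoord S ((splitCoord S).symm (y, z)) = (y, z) :=
    LinearEquiv.apply_symm_apply _ _
  generalize (splitCoord S).symm (y, z) = x at hx
  have hx1 : (splitCoord S x).1 = y := congrArg Prod.fst hx
  have hx2 : (splitCoord S x).2 = z := congrArg Prod.snd hx
  subst hx1 hx2
  obtain ⟨hxm, hxS⟩ := (mem_facet_iff hΓ hc hS).mpr ⟨hy, hz⟩
  refine ⟨x, hxm, hxS, fun T hT hTu hxT => ?_⟩
  by_contra hTS
  -- Only the inequalities of the full vertex sets are tight in the two factors. They stay tight for
  -- right-hand sides that agree with `mass · x` except at `T`.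
  classical
  let c' : Set V → ℝ := fun U => if U = T then mass T x + 1 else mass U x
  have hc'S : mass S x = c' S := (if_neg (Ne.symm hTS)).symm
  have hc'u : mass Set.univ x = c' Set.univ := (if_neg (Ne.symm hTu)).symm
  have := tight_of_tight_factors (c' := c') (y := x) hS hc hxm hxS hc'S
    (fun U hU hUx => by
      by_cases hUu : U = Set.univ
      · rw [← mass_val_image, restrictBound, hUu, Subtype.coe_image_univ, hc'S]
      · exact absurd hUx (hyt U hU hUu))
    (fun U hU hUx => by
      by_cases hUu : U = Set.univ
      · have h1 := mass_val_image_union S U x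
        have h2 : Subtype.val '' U ∪ S = Set.univ := by rw [hUu, val_image_univ_union]
        rw [contractBound_of_connected (by rw [h2]; exact induce_univ_connected_iff.mpr hΓ), h2]
        rw [h2] at h1
        linarith
      · exact absurd hUx (hzt U hU hUu)) hT hxT
  simp only [c', if_true] at this
  linarith

theorem isExtreme_facet (hS : (Γ.induce S).Connected) :
    IsExtreme ℝ (Γ.tubePolytope c) {x ∈ Γ.tubePolytope c | mass S x = c S} := by
  have h := isExtreme_tight (g := mass Set.univ) (r := c Set.univ)
    (a := fun T : {T : Set V // (Γ.induce T).Connected} => mass T.1) (b := fun T => c T.1)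
    {⟨S, hS⟩}
  simp only [Set.mem_singleton_iff, forall_eq] at h
  exact h

theorem convex_facet : Convex ℝ {x ∈ Γ.tubePolytope c | mass S x = c S} :=
  convex_tubePolytope.inter (convex_hyperplane (mass S).isLinear (c S))

/-- Every proper face is contained in one of the facets `x(S) = c S`. -/
theorem exists_tight_on_face {F : Set (V → ℝ)} (hne : F.Nonempty) (hF : Convex ℝ F)
    (he : IsExtreme ℝ (Γ.tubePolytope c) F) (hFne : F ≠ Γ.tubePolytope c) :
    ∃ S, (Γ.induce S).Connected ∧ S ≠ Set.univ ∧ ∀ x ∈ F, mass S x = c S := by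
  obtain ⟨x, hx, hxt⟩ := hF.exists_generic hne
    (fun T : {T : Set V // (Γ.induce T).Connected} => mass T.1) (fun T => c T.1)
    fun x hx => (he.subset hx).2
  by_contra! hcon
  refine hFne (Set.Subset.antisymm he.subset fun y hy =>
    IsExtreme.mem_of_tight he hx hy fun T hT => ?_)
  by_cases hTu : T.1 = Set.univ
  · change mass T.1 y = c T.1
    rw [hTu]
    exact hy.1
  · obtain ⟨z, hz, hzn⟩ := hcon T.1 T.2 hTu
    exact (hzn (hxt T hT z hz)).elim

end General

theorem nonempty_faceOf_orderIso_of_eq {E : Type} [AddCommGroup E] [Module ℝ E] {A B : Set E}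
    (h : A = B) : Nonempty (FaceOf A ≃o FaceOf B) := h ▸ ⟨OrderIso.refl _⟩

variable {k : ℕ} {Λ : SimpleGraph (Fin (k + 1))}

theorem associahedronSet_eq (Λ : SimpleGraph (Fin (k + 1))) :
    Λ.associahedronSet = Λ.tubePolytope powBound := by
  have hu : powBound (Set.univ : Set (Fin (k + 1))) = 3 ^ (k + 1) := by simp [powBound]
  have hm : ∀ x : Fin (k + 1) → ℝ, mass Set.univ x = ∑ i, x i := fun x =>
    (finsum_mem_univ x).trans (finsum_eq_sum_of_fintype x)
  ext x
  rw [mem_tubePolytope, hu, hm]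
  refine and_congr_right fun hx => ⟨fun h T hT => ?_, fun h S hS _ => ?_⟩
  · by_cases hTu : T = Set.univ
    · rw [hTu, hu, hm, hx]
    · obtain ⟨S, rfl⟩ : ∃ S : Finset (Fin (k + 1)), T = S :=
        ⟨T.toFinite.toFinset, (Set.Finite.coe_toFinset _).symm⟩
      have := h S hT fun h => hTu (by rw [h, Finset.coe_univ])
      rw [powBound, Set.ncard_coe_finset]
      exact this.trans_eq (finsum_mem_coe_finset x S).symm
  · have := h S hS
    rw [powBound, Set.ncard_coe_finset] at this
    exact this.trans_eq (finsum_mem_coe_finset x S)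

/-- The combinatorial type of the graph-associahedron depends only on the isomorphism class of the
graph. -/
theorem Iso.toClass_associahedron {j : ℕ} {Λ' : SimpleGraph (Fin (j + 1))} (e : Λ ≃g Λ')
    (hΛ : Λ.Connected) : Λ.associahedron.toClass = Λ'.associahedron.toClass := by
  obtain ⟨f⟩ := nonempty_faceOf_orderIso_of_eq (associahedronSet_eq Λ)
  obtain ⟨g⟩ := nonempty_faceOf_orderIso_of_eq (associahedronSet_eq Λ')
  obtain ⟨h⟩ := e.nonempty_faceOf_orderIso hΛ (admissible_powBound Λ) (admissible_powBound Λ')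
  exact Polytope.toClass_eq_iff.mpr ⟨(f.trans h).trans g.symm⟩

/-- The face of the graph-associahedron given by a proper connected set `S` of vertices. -/
noncomputable def tubeFace (hΛ : Λ.Connected) {S : Set (Fin (k + 1))}
    (hS : (Λ.induce S).Connected) (hne : S ≠ Set.univ) : Λ.associahedron.Face :=
  ⟨{x ∈ Λ.tubePolytope powBound | mass S x = powBound S}, by
    obtain ⟨x, hx, hxS, -⟩ := exists_generic_on_facet hΛ (admissible_powBound Λ) hS hne
    exact ⟨x, hx, hxS⟩, convex_facet, by
    change IsExtreme ℝ Λ.associahedronSet _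
    rw [associahedronSet_eq Λ]
    exact isExtreme_facet hS⟩

theorem subset_of_tubeFace_le (hΛ : Λ.Connected) {S T : Set (Fin (k + 1))}
    (hS : (Λ.induce S).Connected) (hne : S ≠ Set.univ) (hT : (Λ.induce T).Connected)
    (hTne : T ≠ Set.univ) (h : tubeFace hΛ hS hne ≤ tubeFace hΛ hT hTne) : S = T := by
  obtain ⟨x, hx, hxS, hxt⟩ := exists_generic_on_facet hΛ (admissible_powBound Λ) hS hne
  exact (hxt T hT hTne (h (show x ∈ (tubeFace hΛ hS hne).1 from ⟨hx, hxS⟩)).2).symm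

theorem tubeFace_ne_top (hΛ : Λ.Connected) {S : Set (Fin (k + 1))}
    (hS : (Λ.induce S).Connected) (hne : S ≠ Set.univ) : tubeFace hΛ hS hne ≠ ⊤ := by
  intro h
  obtain ⟨x, hx, hxt⟩ := exists_interior hΛ (admissible_powBound Λ)
  have : x ∈ (⊤ : Λ.associahedron.Face).1 := (associahedronSet_eq Λ).symm.subset hx
  rw [← h] at this
  exact hxt S hS hne this.2

theorem exists_le_tubeFace (hΛ : Λ.Connected) {F : Λ.associahedron.Face} (hF : F ≠ ⊤) :
    ∃ (S : Set (Fin (k + 1))) (hS : (Λ.induce S).Connected) (hne : S ≠ Set.univ),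
      F ≤ tubeFace hΛ hS hne := by
  have he : IsExtreme ℝ (Λ.tubePolytope powBound) F.1 := associahedronSet_eq Λ ▸ F.2.2.2
  obtain ⟨S, hS, hne, h⟩ := exists_tight_on_face F.2.1 F.2.2.1 he fun h =>
    hF (Subtype.ext (h.trans (associahedronSet_eq Λ).symm))
  exact ⟨S, hS, hne, fun x hx => ⟨he.subset hx, h x hx⟩⟩

/-- The face of `S` is maximal: a larger proper face lies in the face of some `T`, which has to be
`S` by the generic point of the face of `S`. -/
theorem isCoatom_tubeFace (hΛ : Λ.Connected) {S : Set (Fin (k + 1))}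
    (hS : (Λ.induce S).Connected) (hne : S ≠ Set.univ) : IsCoatom (tubeFace hΛ hS hne) := by
  refine ⟨tubeFace_ne_top hΛ hS hne, fun G hG => ?_⟩
  by_contra hGt
  obtain ⟨T, hT, hTne, hGT⟩ := exists_le_tubeFace hΛ hGt
  obtain rfl := subset_of_tubeFace_le hΛ hS hne hT hTne (hG.le.trans hGT)
  exact hG.not_ge hGT

theorem exists_eq_tubeFace (hΛ : Λ.Connected) {F : Λ.associahedron.Face} (hF : IsCoatom F) :
    ∃ (S : Set (Fin (k + 1))) (hS : (Λ.induce S).Connected) (hne : S ≠ Set.univ),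
      F = tubeFace hΛ hS hne := by
  obtain ⟨S, hS, hne, h⟩ := exists_le_tubeFace hΛ hF.1
  refine ⟨S, hS, hne, ?_⟩
  by_contra hc
  exact tubeFace_ne_top hΛ hS hne (hF.2 _ (lt_of_le_of_ne h hc))

/-- The facets of a graph-associahedron correspond to the proper connected sets of vertices. -/
theorem numFacets_associahedron (hΛ : Λ.Connected) : Λ.associahedron.toClass.numFacets =
    {S : Set (Fin (k + 1)) | (Λ.induce S).Connected ∧ S ≠ Set.univ}.ncard := by
  refine (Nat.card_congr (Equiv.ofBijective (fun S => ⟨tubeFace hΛ S.2.1 S.2.2,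
    isCoatom_tubeFace hΛ S.2.1 S.2.2⟩) ⟨fun S T h => ?_, fun F => ?_⟩)).symm
  · exact Subtype.ext
      (subset_of_tubeFace_le hΛ S.2.1 S.2.2 T.2.1 T.2.2 (Subtype.ext_iff.mp h).le)
  · obtain ⟨S, hS, hne, h⟩ := exists_eq_tubeFace hΛ F.2
    exact ⟨⟨S, hS, hne⟩, Subtype.ext h.symm⟩

/-- The facet of `S` is the product of the graph-associahedra of the restriction to `S` and of the
contraction of `S`. -/
theorem toClass_tubeFace (hΛ : Λ.Connected) {S : Set (Fin (k + 1))}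
    (hS : (Λ.induce S).Connected) (hne : S ≠ Set.univ) {i j : ℕ}
    {Λ₁ : SimpleGraph (Fin (i + 1))} {Λ₂ : SimpleGraph (Fin (j + 1))}
    (e₁ : Λ.induce S ≃g Λ₁) (e₂ : Λ.contraction S ≃g Λ₂) :
    (tubeFace hΛ hS hne).toPolytope.toClass =
      Λ₁.associahedron.toClass * Λ₂.associahedron.toClass := by
  have hcon := contraction_connected hΛ hS hne
  have hadm := admissible_powBound Λ
  have hset : (tubeFace hΛ hS hne).1 = splitCoord S ⁻¹'
      ((Λ.induce S).tubePolytope (restrictBound powBound S) ×ˢ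
        (Λ.contraction S).tubePolytope (contractBound Λ powBound S)) :=
    Set.ext fun x => mem_facet_iff hΛ hadm hS
  obtain ⟨f⟩ := nonempty_faceOf_orderIso_of_eq hset
  obtain ⟨g₁⟩ := nonempty_faceOf_orderIso_of_eq (associahedronSet_eq Λ₁)
  obtain ⟨g₂⟩ := nonempty_faceOf_orderIso_of_eq (associahedronSet_eq Λ₂)
  obtain ⟨h₁⟩ := e₁.nonempty_faceOf_orderIso hS (hadm.restrict S) (admissible_powBound Λ₁)
  obtain ⟨h₂⟩ := e₂.nonempty_faceOf_orderIso hcon (hadm.contract hS) (admissible_powBound Λ₂)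
  refine Polytope.toClass_eq_iff.mpr ⟨?_⟩
  exact (((f.trans (FaceOf.preimageIso (splitCoord S) _)).trans (FaceOf.prodIso _ _)).trans
    (Polytope.prodMap (h₁.trans g₁.symm) (h₂.trans g₂.symm))).trans
      (Polytope.prodFaceIso Λ₁.associahedron Λ₂.associahedron).symm

end SimpleGraph

/-! ### Recognizing paths and complete graphs -/

namespace SimpleGraph

variable {V : Type} {Γ : SimpleGraph V}

/-- A connected graph that is not complete has an induced path on three vertices. -/
theorem Connected.exists_induced_path (hΓ : Γ.Connected) (h : Γ ≠ ⊤) :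
    ∃ a b c, Γ.Adj a b ∧ Γ.Adj b c ∧ a ≠ c ∧ ¬Γ.Adj a c := by
  obtain ⟨u, w, huw, hadj⟩ := ne_top_iff_exists_not_adj.mp h
  obtain ⟨x, hx, y, hy, hxy⟩ := hΓ.exists_adj_of_ne_univ (T := {x | x = u ∨ Γ.Adj u x})
    ⟨u, .inl rfl⟩ fun h => (h.symm.subset (Set.mem_univ w)).elim (fun h => huw h.symm) hadj
  simp only [Set.mem_ofPred_eq, not_or] at hx hy
  rcases hx with rfl | hx
  · exact (hy.2 hxy).elim
  · exact ⟨u, x, y, hx, hxy, Ne.symm hy.1, hy.2⟩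

theorem induce_triple_connected {a b c : V} (hab : Γ.Adj a b) (hbc : Γ.Adj b c) :
    (Γ.induce {a, b, c}).Connected := by
  have := induce_union_connected_of_adj (induce_singleton_connected a) (induce_pair_connected hbc)
    rfl (Set.mem_insert b {c}) hab
  rwa [Set.singleton_union] at this

/-- The vertices `f 0, …, f (m - 1)` are distinct and form a path. -/
def IsPathSeq (Γ : SimpleGraph V) (f : ℕ → V) (m : ℕ) : Prop :=
  Set.InjOn f (Set.Iio m) ∧ ∀ i, i + 1 < m → Γ.Adj (f i) (f (i + 1))

theorem IsPathSeq.induce_connected {f : ℕ → V} {m : ℕ} (hf : Γ.IsPathSeq f m) {i j : ℕ}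
    (hij : i ≤ j) (hj : j < m) : (Γ.induce (f '' Set.Icc i j)).Connected := by
  induction j, hij using Nat.le_induction with
  | base =>
    rw [Set.Icc_self, Set.image_singleton]
    exact induce_singleton_connected _
  | succ j hij ih =>
    have := induce_union_connected_of_adj (ih (by omega)) (induce_singleton_connected (f (j + 1)))
      ⟨j, ⟨hij, le_rfl⟩, rfl⟩ rfl (hf.2 j hj)
    rwa [← Set.image_singleton, ← Set.image_union,
      show Set.Icc i j ∪ {j + 1} = Set.Icc i (j + 1) by ext; simp; omega] at this

/-- A finite nonempty graph has a path that is not extendable to a path with one more vertex. -/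
theorem exists_maximal_isPathSeq [Finite V] [Nonempty V] (Γ : SimpleGraph V) :
    ∃ f m, 0 < m ∧ Γ.IsPathSeq f m ∧ ∀ g, ¬Γ.IsPathSeq g (m + 1) := by
  by_contra! hcon
  have key : ∀ m, ∃ f, Γ.IsPathSeq f (m + 1) := by
    intro m
    induction m with
    | zero =>
      refine ⟨fun _ => Classical.arbitrary V, fun i hi j hj _ => ?_, fun i hi => by omega⟩
      simp only [Set.mem_Iio] at hi hj
      omega
    | succ m ih =>
      obtain ⟨f, hf⟩ := ih
      exact hcon f (m + 1) (Nat.succ_pos m) hf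
  obtain ⟨f, hf, -⟩ := key (Nat.card V)
  have := Set.InjOn.ncard_image hf
  have h2 := Set.ncard_le_card (f '' Set.Iio (Nat.card V + 1))
  rw [this, Set.ncard_eq_toFinset_card', Set.toFinset_Iio, Nat.card_Iio] at h2
  omega

/-- A finite connected graph is a path if neither the graph nor any of its contractions by a
connected set contains a triangle. If a longest path misses a vertex, then the contraction of an
inner vertex of the path contains a triangle. If there is an edge besides those of the path, it
closes a cycle, which contracts to a triangle. -/
theorem Connected.nonempty_iso_pathGraph {k : ℕ} {Γ : SimpleGraph (Fin (k + 1))}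
    (hΓ : Γ.Connected) (htri : ∀ a b c, Γ.Adj a b → Γ.Adj b c → Γ.Adj a c → False)
    (hcon : ∀ S, (Γ.induce S).Connected → ∀ a b c, (Γ.contraction S).Adj a b →
      (Γ.contraction S).Adj b c → (Γ.contraction S).Adj a c → False) :
    Nonempty (Γ ≃g pathGraph (k + 1)) := by
  obtain ⟨f, m, hm, hf, hmax⟩ := exists_maximal_isPathSeq Γ
  have hne : ∀ i j, i < m → j < m → i ≠ j → f i ≠ f j := fun i j hi hj hij h =>
    hij (hf.1 hi hj h)
  have hsurj : f '' Set.Iio m = Set.univ := by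
    by_contra hns
    obtain ⟨_, ⟨i, hi, rfl⟩, w, hw, hiw⟩ := hΓ.exists_adj_of_ne_univ
      ⟨f 0, Set.mem_image_of_mem f hm⟩ hns
    have hi : i < m := hi
    have hw : ∀ j < m, f j ≠ w := fun j hj h => hw ⟨j, hj, h⟩
    rcases Nat.eq_zero_or_pos i with rfl | hi0
    · -- prepend `w`
      refine hmax (fun j => if j = 0 then w else f (j - 1)) ⟨fun a ha b hb hab => ?_,
        fun j hj => ?_⟩
      · simp only [Set.mem_Iio] at ha hb
        dsimp only at hab
        split_ifs at hab with h1 h2 h2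
        · omega
        · exact (hw _ (by omega) hab.symm).elim
        · exact (hw _ (by omega) hab).elim
        · have := hf.1 (show a - 1 < m by omega) (show b - 1 < m by omega) hab
          omega
      · rcases j with _ | j
        · simpa using hiw.symm
        · simpa using hf.2 j (by omega)
    by_cases him : i + 1 = m
    · -- append `w`
      refine hmax (fun j => if j = m then w else f j) ⟨fun a ha b hb hab => ?_, fun j hj => ?_⟩
      · simp only [Set.mem_Iio] at ha hb
        dsimp only at hab
        split_ifs at hab with h1 h2 h2
        · omega
        · exact (hw _ (by omega) hab.symm).elim
        · exact (hw _ (by omega) hab).elim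
        · exact hf.1 (show a < m by omega) (show b < m by omega) hab
      · dsimp only
        rw [if_neg (by omega)]
        split_ifs with h1
        · rwa [show j = i by omega]
        · exact hf.2 j (by omega)
    · -- `f i` has the three neighbours `f (i - 1)`, `f (i + 1)` and `w`
      have h1 := hf.2 (i - 1) (by omega)
      rw [Nat.sub_add_cancel hi0] at h1
      have h2 := hf.2 i (by omega)
      have hS := induce_singleton_connected (Γ := Γ) (f i)
      have hadj : ∀ (a b : {v // v ∉ ({f i} : Set _)}), a.1 ≠ b.1 → Γ.Adj (f i) a.1 →
          Γ.Adj (f i) b.1 → (Γ.contraction {f i}).Adj a b := fun a b hab ha hb =>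
        (contraction_adj_iff hS).mpr ⟨fun h => hab (congrArg _ h),
          .inr ⟨⟨_, rfl, ha.symm⟩, _, rfl, hb.symm⟩⟩
      have e1 : f (i - 1) ≠ f (i + 1) := hne _ _ (by omega) (by omega) (by omega)
      exact hcon {f i} hS ⟨f (i - 1), h1.ne⟩ ⟨f (i + 1), h2.ne'⟩ ⟨w, hiw.ne'⟩
        (hadj _ _ e1 h1.symm h2) (hadj _ _ (hw _ (by omega)) h2 hiw)
        (hadj _ _ (hw _ (by omega)) h1.symm hiw)
  have hmk : m = k + 1 := by
    have := Set.InjOn.ncard_image hf.1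
    rw [hsurj, Set.ncard_univ, Nat.card_fin, Set.ncard_eq_toFinset_card', Set.toFinset_Iio,
      Nat.card_Iio] at this
    exact this.symm
  subst hmk
  have hchord : ∀ i j, i < j → j < k + 1 → Γ.Adj (f i) (f j) → i + 1 = j := by
    intro i j hij hj hadj
    by_contra hne1
    have h1 := hf.2 i (by omega)
    by_cases hj2 : i + 2 = j
    · subst hj2
      exact htri _ _ _ h1 (hf.2 (i + 1) hj) hadj
    · have hS := hf.induce_connected (i := i + 2) (j := j - 1) (by omega) (by omega)
      have hmem : ∀ l, l < k + 1 → (l < i + 2 ∨ j - 1 < l) →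
          f l ∉ f '' Set.Icc (i + 2) (j - 1) := by
        rintro l hl hlt ⟨l', hl', h⟩
        simp only [Set.mem_Icc] at hl'
        exact hne l' l (by omega) hl (by omega) h
      have h2 := hf.2 (i + 1) (by omega)
      have h3 := hf.2 (j - 1) (by omega)
      rw [Nat.sub_add_cancel (by omega)] at h3
      refine hcon _ hS ⟨f i, hmem i (by omega) (by omega)⟩
        ⟨f (i + 1), hmem (i + 1) (by omega) (by omega)⟩ ⟨f j, hmem j hj (by omega)⟩
        ((contraction_adj_iff hS).mpr ⟨fun h => h1.ne (congrArg Subtype.val h), .inl h1⟩)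
        ((contraction_adj_iff hS).mpr ⟨fun h => hne (i + 1) j (by omega) hj (by omega)
          (congrArg Subtype.val h), .inr ⟨⟨_, ⟨i + 2, ⟨le_rfl, by omega⟩, rfl⟩, h2⟩,
            _, ⟨j - 1, ⟨by omega, le_rfl⟩, rfl⟩, h3.symm⟩⟩)
        ((contraction_adj_iff hS).mpr ⟨fun h => hadj.ne (congrArg Subtype.val h), .inl hadj⟩)
  have hbij : Function.Bijective fun i : Fin (k + 1) => f i := by
    refine Function.Injective.bijective_of_finite fun i j h => ?_
    exact Fin.ext (hf.1 i.2 j.2 h)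
  refine ⟨(show pathGraph (k + 1) ≃g Γ from ⟨Equiv.ofBijective _ hbij, fun {i j} => ?_⟩).symm⟩
  rw [pathGraph_adj, Equiv.ofBijective_apply, Equiv.ofBijective_apply]
  constructor
  · intro h
    rcases lt_trichotomy i.1 j.1 with hij | hij | hij
    · exact .inl (hchord _ _ hij j.2 h)
    · exact (h.ne (congrArg f hij)).elim
    · exact .inr (hchord _ _ hij i.2 h.symm)
  · rintro (h | h)
    · rw [← h]
      exact hf.2 _ (by omega)
    · rw [← h]
      exact (hf.2 _ (by omega)).symm

theorem card_triple {a b c : V} (hab : a ≠ b) (hac : a ≠ c) (hbc : b ≠ c) :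
    Nat.card ({a, b, c} : Set V) = 3 := by
  rw [Nat.card_coe_set_eq, Set.ncard_eq_three]
  exact ⟨a, b, c, hab, hac, hbc, rfl⟩

/-- A class of connected graphs which is closed under restriction to and contraction of connected
sets consists of paths if its members with three vertices are not complete, and of complete graphs
if its members with three vertices are complete. -/
theorem paths_or_complete (𝒢 : ∀ V : Type, SimpleGraph V → Prop)
    (hconn : ∀ (V : Type) (Γ : SimpleGraph V), 𝒢 V Γ → Γ.Connected)
    (hind : ∀ (V : Type) (Γ : SimpleGraph V), 𝒢 V Γ → ∀ S, (Γ.induce S).Connected →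
      𝒢 S (Γ.induce S))
    (hcon : ∀ (V : Type) (Γ : SimpleGraph V), 𝒢 V Γ → ∀ S, (Γ.induce S).Connected → S ≠ Set.univ →
      𝒢 {v // v ∉ S} (Γ.contraction S))
    (hthree : (∀ (V : Type) (Γ : SimpleGraph V), 𝒢 V Γ → Nat.card V = 3 → Γ ≠ ⊤) ∨
      ∀ (V : Type) (Γ : SimpleGraph V), 𝒢 V Γ → Nat.card V = 3 → Γ = ⊤)
    (Γ : ∀ k : ℕ, SimpleGraph (Fin (k + 1))) (hΓ : ∀ k, 𝒢 _ (Γ k)) :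
    (∀ k, Nonempty (Γ k ≃g pathGraph (k + 1))) ∨ ∀ k, Γ k = ⊤ := by
  refine hthree.imp (fun h3 k => ?_) fun h3 k => ?_
  · have htri : ∀ (V : Type) (Γ : SimpleGraph V), 𝒢 V Γ →
        ∀ a b c, Γ.Adj a b → Γ.Adj b c → Γ.Adj a c → False := by
      intro V Γ hΓ a b c hab hbc hac
      refine h3 _ _ (hind V Γ hΓ {a, b, c} (induce_triple_connected hab hbc))
        (card_triple hab.ne hac.ne hbc.ne) ?_
      ext ⟨x, hx⟩ ⟨y, hy⟩
      rw [top_adj]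
      refine ⟨fun h => h.ne, fun h => ?_⟩
      have h : x ≠ y := fun h' => h (Subtype.ext h')
      change Γ.Adj x y
      rcases hx with rfl | rfl | rfl <;> rcases hy with rfl | rfl | rfl <;>
        first | exact (h rfl).elim | assumption | (apply Adj.symm; assumption)
    refine (hconn _ _ (hΓ k)).nonempty_iso_pathGraph (htri _ _ (hΓ k)) ?_
    intro S hS a
    have hne : S ≠ Set.univ := fun h => a.2 (h.symm.subset trivial)
    exact htri _ _ (hcon _ _ (hΓ k) S hS hne) a
  · by_contra hne
    obtain ⟨a, b, c, hab, hbc, hne, hac⟩ := (hconn _ _ (hΓ k)).exists_induced_path hne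
    have := h3 _ _ (hind _ _ (hΓ k) {a, b, c} (induce_triple_connected hab hbc))
      (card_triple hab.ne hne hbc.ne)
    have h1 : ((Γ k).induce {a, b, c}).Adj ⟨a, by simp⟩ ⟨c, by simp⟩ := by
      rw [this, top_adj]
      exact fun h => hne (congrArg Subtype.val h)
    exact hac h1

/-- A finite nonempty graph is isomorphic to a graph with vertices `0, …, k`. -/
theorem exists_iso_fin [Finite V] [Nonempty V] (Γ : SimpleGraph V) :
    ∃ (k : ℕ) (Λ : SimpleGraph (Fin (k + 1))), Nonempty (Γ ≃g Λ) := by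
  obtain ⟨k, hk⟩ := Nat.exists_eq_succ_of_ne_zero (Nat.card_pos (α := V)).ne'
  exact ⟨k, _, ⟨Iso.map (Finite.equivFinOfCardEq hk) Γ⟩⟩

theorem Iso.eq_top_iff {W : Type} {Λ : SimpleGraph W} (e : Γ ≃g Λ) : Γ = ⊤ ↔ Λ = ⊤ := by
  constructor
  · rintro rfl
    ext x y
    rw [← e.symm.map_adj_iff, top_adj, top_adj, e.symm.injective.ne_iff]
  · rintro rfl
    ext x y
    rw [← e.map_adj_iff, top_adj, top_adj, e.injective.ne_iff]

theorem Iso.eq_of_card {k n : ℕ} {Λ : SimpleGraph (Fin (k + 1))} (e : Γ ≃g Λ)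
    (h : Nat.card V = n + 1) : k = n := by
  rw [Nat.card_congr e.toEquiv, Nat.card_fin] at h
  omega

theorem Iso.image_ne_univ {W : Type} {Λ : SimpleGraph W} (e : Γ ≃g Λ) {S : Set V}
    (h : S ≠ Set.univ) : e '' S ≠ Set.univ := fun h' => h (by
  rw [← Set.preimage_image_eq S e.injective, h', Set.preimage_univ])

/-- An isomorphism of graphs restricts to induced subgraphs. -/
def Iso.induceImage {W : Type} {Λ : SimpleGraph W} (e : Γ ≃g Λ) (S : Set V) :
    Γ.induce S ≃g Λ.induce (e '' S) where
  toEquiv := e.toEquiv.image S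
  map_rel_iff' := e.map_adj_iff

theorem Iso.nonempty_contraction_iso {W : Type} {Λ : SimpleGraph W} (e : Γ ≃g Λ) {S : Set V}
    (hS : (Γ.induce S).Connected) : Nonempty (Γ.contraction S ≃g Λ.contraction (e '' S)) := by
  refine ⟨⟨e.toEquiv.subtypeEquiv fun v => (e.injective.mem_set_image).not.symm, fun {i j} => ?_⟩⟩
  rw [contraction_adj_iff hS, contraction_adj_iff (e.induce_image_connected_iff.mpr hS)]
  simp only [ne_eq, Equiv.subtypeEquiv_apply, RelIso.coe_fn_toEquiv,
    e.injective.eq_iff, Set.exists_mem_image, e.map_adj_iff, Subtype.ext_iff]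

end SimpleGraph

/-! ### Restrictions and contractions of paths and complete graphs -/

namespace SimpleGraph

/-- In a set of vertices of a path that does not contain `w`, no vertex before `w` is connected to a
vertex after `w`. -/
theorem lt_of_reachable_of_notMem {n : ℕ} {T : Set (Fin n)} {i j : T} {w : Fin n} (hw : w ∉ T)
    (hi : i.1 < w) (h : ((pathGraph n).induce T).Reachable i j) : j.1 < w := by
  refine h.mem_of_closed (A := {x | x < w}) hi fun x hx _ y hy hxy => ?_
  have hyw : y ≠ w := fun h => hw (h ▸ hy)
  rw [pathGraph_adj] at hxy
  simp only [Set.mem_ofPred_eq] at hx ⊢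
  omega

/-- A graph on some vertices of a path is a path if it joins consecutive ones among these. -/
theorem exists_iso_pathGraph {n : ℕ} {p : Fin n → Prop} (hp : ∃ v, p v)
    (Λ : SimpleGraph {v // p v})
    (h : ∀ i j : {v // p v}, i < j → (Λ.Adj i j ↔ ∀ w, i.1 < w → w < j.1 → ¬p w)) :
    ∃ k, Nonempty (Λ ≃g pathGraph (k + 1)) := by
  classical
  obtain ⟨v, hv⟩ := hp
  obtain ⟨k, hk⟩ := Nat.exists_eq_succ_of_ne_zero
    (Fintype.card_pos_iff.mpr ⟨(⟨v, hv⟩ : {v // p v})⟩).ne'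
  let o : Fin (k + 1) ≃o {v // p v} := Fintype.orderIsoFinOfCardEq _ hk
  have key : ∀ a b : Fin (k + 1), a < b → (Λ.Adj (o a) (o b) ↔ a.1 + 1 = b.1) := by
    intro a b hab
    rw [h _ _ (o.lt_iff_lt.mpr hab)]
    constructor
    · intro hw
      by_contra hne
      have h1 : a < (⟨a.1 + 1, by omega⟩ : Fin (k + 1)) := Fin.lt_def.mpr (by simp)
      have h2 : (⟨a.1 + 1, by omega⟩ : Fin (k + 1)) < b := Fin.lt_def.mpr (by simp; omega)
      exact hw _ (o.lt_iff_lt.mpr h1) (o.lt_iff_lt.mpr h2) (Subtype.property _)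
    · intro hab' w hw1 hw2 hw
      obtain ⟨c, hc⟩ := o.surjective ⟨w, hw⟩
      have h1 : o a < o c := hc ▸ hw1
      have h2 : o c < o b := hc ▸ hw2
      rw [o.lt_iff_lt] at h1 h2
      omega
  refine ⟨k, ⟨(show pathGraph (k + 1) ≃g Λ from ⟨o.toEquiv, fun {a b} => ?_⟩).symm⟩⟩
  rw [pathGraph_adj]
  change Λ.Adj (o a) (o b) ↔ _
  rcases lt_trichotomy a b with hab | rfl | hab
  · rw [key a b hab]
    omega
  · exact iff_of_false (fun h => h.ne rfl) (by omega)
  · rw [adj_comm, key b a hab]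
    omega

theorem exists_induce_pathGraph_iso {n : ℕ} {S : Set (Fin n)}
    (hS : ((pathGraph n).induce S).Connected) :
    ∃ k, Nonempty ((pathGraph n).induce S ≃g pathGraph (k + 1)) := by
  refine exists_iso_pathGraph (Set.nonempty_coe_sort.mp hS.nonempty) _ fun i j hij => ?_
  have hij' : i.1 < j.1 := hij
  rw [induce_adj, pathGraph_adj]
  constructor
  · intro h w h1 h2
    omega
  · intro h
    by_contra hne
    have hw := h ⟨i.1.1 + 1, by omega⟩ (Fin.lt_def.mpr (by simp)) (Fin.lt_def.mpr (by simp; omega))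
    have := lt_of_reachable_of_notMem hw (Fin.lt_def.mpr (by simp)) (hS.preconnected i j)
    rw [Fin.lt_def] at this
    simp only at this
    omega

theorem exists_contraction_pathGraph_iso {n : ℕ} {S : Set (Fin n)} (hne : S ≠ Set.univ) :
    ∃ k, Nonempty ((pathGraph n).contraction S ≃g pathGraph (k + 1)) := by
  refine exists_iso_pathGraph ((Set.ne_univ_iff_exists_notMem S).mp hne) _ fun i j hij => ?_
  have hij' : i.1 < j.1 := hij
  constructor
  · rintro ⟨-, h⟩ w h1 h2 hw
    refine h2.not_gt (lt_of_reachable_of_notMem (T := S ∪ {i.1, j.1}) (i := ⟨i.1, by simp⟩)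
      (j := ⟨j.1, by simp⟩) ?_ h1 h)
    rintro (h | rfl | rfl)
    · exact hw h
    · exact h1.false
    · exact h2.false
  · intro h
    push Not at h
    -- all vertices between `i` and `j` lie in `S`
    have hmem : ∀ t : Fin n, i.1 ≤ t → t ≤ j.1 → t ∈ S ∪ {i.1, j.1} := by
      intro t h1 h2
      rcases h1.eq_or_lt with rfl | h1
      · exact .inr (.inl rfl)
      rcases h2.eq_or_lt with rfl | h2
      · exact .inr (.inr rfl)
      exact .inl (h t h1 h2)
    have hreach : ∀ t (ht : t < n) (h1 : i.1 ≤ ⟨t, ht⟩) (h2 : ⟨t, ht⟩ ≤ j.1),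
        ((pathGraph n).induce (S ∪ {i.1, j.1})).Reachable ⟨i.1, by simp⟩
          ⟨⟨t, ht⟩, hmem _ h1 h2⟩ := by
      intro t
      induction t with
      | zero =>
        intro ht h1 h2
        have : (⟨i.1, by simp⟩ : (S ∪ {i.1, j.1} : Set (Fin n))) = ⟨⟨0, ht⟩, hmem _ h1 h2⟩ :=
          Subtype.ext (le_antisymm h1 (Fin.le_def.mpr (Nat.zero_le _)))
        rw [this]
      | succ t ih =>
        intro ht h1 h2
        rcases h1.eq_or_lt with h1' | h1'
        · have : (⟨i.1, by simp⟩ : (S ∪ {i.1, j.1} : Set (Fin n))) =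
              ⟨⟨t + 1, ht⟩, hmem _ h1 h2⟩ := Subtype.ext h1'
          rw [this]
        · have h3 : i.1 ≤ (⟨t, by omega⟩ : Fin n) := Fin.le_def.mpr (Nat.lt_succ_iff.mp h1')
          have h4 : (⟨t, by omega⟩ : Fin n) ≤ j.1 :=
            Fin.le_def.mpr ((Nat.le_succ t).trans (Fin.le_def.mp h2))
          refine (ih (by omega) h3 h4).trans (Adj.reachable ?_)
          rw [induce_adj, pathGraph_adj]
          exact .inl rfl
    exact ⟨hij.ne, hreach j.1.1 j.1.2 hij'.le le_rfl⟩

theorem contraction_top {V : Type} (S : Set V) : (⊤ : SimpleGraph V).contraction S = ⊤ := by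
  ext i j
  refine ⟨fun h => h.1, fun h => ⟨h, Adj.reachable ?_⟩⟩
  exact fun h' => h (Subtype.ext h')

theorem exists_iso_top {V : Type} [Finite V] [Nonempty V] :
    ∃ k, Nonempty ((⊤ : SimpleGraph V) ≃g (⊤ : SimpleGraph (Fin (k + 1)))) := by
  obtain ⟨k, Λ, ⟨e⟩⟩ := exists_iso_fin (⊤ : SimpleGraph V)
  obtain rfl := e.eq_top_iff.mp rfl
  exact ⟨k, ⟨e⟩⟩

/-! ### Families of graphs and the facets of their associahedra -/

section Family

variable {Γ : ∀ k : ℕ, SimpleGraph (Fin (k + 1))}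

/-- If a family of graphs is closed under restriction and contraction, then the facets of the
graph-associahedra are products of graph-associahedra of the family. -/
theorem isFacet_mem_of_family (hΓ : ∀ k, (Γ k).Connected)
    (h : ∀ (k : ℕ) (S : Set (Fin (k + 1))), ((Γ k).induce S).Connected → S ≠ Set.univ →
      (∃ j, Nonempty ((Γ k).induce S ≃g Γ j)) ∧ ∃ j, Nonempty ((Γ k).contraction S ≃g Γ j)) :
    ∀ X ∈ Set.range fun k => (Γ k).associahedron.toClass, ∀ Y, Polytope.Class.IsFacet Y X →
      Y ∈ Submonoid.closure (Set.range fun k => (Γ k).associahedron.toClass) := by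
  rintro _ ⟨k, rfl⟩ Y hY
  obtain ⟨F, hF, rfl⟩ := Polytope.Class.isFacet_toClass.mp hY
  obtain ⟨S, hS, hne, rfl⟩ := exists_eq_tubeFace (hΓ k) hF
  obtain ⟨⟨i, ⟨e₁⟩⟩, j, ⟨e₂⟩⟩ := h k S hS hne
  rw [toClass_tubeFace (hΓ k) hS hne e₁ e₂]
  exact mul_mem (Submonoid.subset_closure ⟨i, rfl⟩) (Submonoid.subset_closure ⟨j, rfl⟩)

/-- The facet of `S` as a product of two graph-associahedra on standard vertex sets. -/
theorem exists_toClass_tubeFace_eq_mul {k : ℕ} {Λ : SimpleGraph (Fin (k + 1))} (hΛ : Λ.Connected)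
    {S : Set (Fin (k + 1))} (hS : (Λ.induce S).Connected) (hne : S ≠ Set.univ) :
    ∃ (i j : ℕ) (Λ₁ : SimpleGraph (Fin (i + 1))) (Λ₂ : SimpleGraph (Fin (j + 1))),
      Nonempty (Λ.induce S ≃g Λ₁) ∧ Nonempty (Λ.contraction S ≃g Λ₂) ∧
      (tubeFace hΛ hS hne).toPolytope.toClass =
        Λ₁.associahedron.toClass * Λ₂.associahedron.toClass := by
  have := hS.nonempty
  have := (contraction_connected hΛ hS hne).nonempty
  obtain ⟨i, Λ₁, ⟨e₁⟩⟩ := exists_iso_fin (Λ.induce S)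
  obtain ⟨j, Λ₂, ⟨e₂⟩⟩ := exists_iso_fin (Λ.contraction S)
  exact ⟨i, j, Λ₁, Λ₂, ⟨e₁⟩, ⟨e₂⟩, toClass_tubeFace hΛ hS hne e₁ e₂⟩

/-- The connected graphs whose associahedron has its combinatorial type in `M`. -/
def AssociahedronMem (M : Set Polytope.Class) (V : Type) (Γ : SimpleGraph V) : Prop :=
  Γ.Connected ∧ ∃ (k : ℕ) (Λ : SimpleGraph (Fin (k + 1))), Nonempty (Γ ≃g Λ) ∧
    Λ.associahedron.toClass ∈ M

variable {M : Submonoid Polytope.Class} {V : Type} {Γ : SimpleGraph V}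

/-- If a monoid of combinatorial types is closed under passing to facets, then the class of
connected graphs whose associahedra belong to it is closed under restriction and contraction. -/
theorem AssociahedronMem.induce_and_contraction
    (hM : ∀ X ∈ M, ∀ Y, Polytope.Class.IsFacet Y X → Y ∈ M) (h : AssociahedronMem M V Γ)
    {S : Set V} (hS : (Γ.induce S).Connected) (hne : S ≠ Set.univ) :
    AssociahedronMem M S (Γ.induce S) ∧ AssociahedronMem M {v // v ∉ S} (Γ.contraction S) := by
  obtain ⟨hΓ, k, Λ, ⟨e⟩, hΛM⟩ := h
  have hΛ := e.connected_iff.mp hΓ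
  have hne' := e.image_ne_univ hne
  have hS' := e.induce_image_connected_iff.mpr hS
  obtain ⟨i, j, Λ₁, Λ₂, ⟨e₁⟩, ⟨e₂⟩, hcl⟩ := exists_toClass_tubeFace_eq_mul hΛ hS' hne'
  have hmem := hM _ hΛM _ (Polytope.Class.isFacet_toClass.mpr
    ⟨_, isCoatom_tubeFace hΛ hS' hne', hcl⟩)
  obtain ⟨f⟩ := e.nonempty_contraction_iso hS
  have hV : Finite V := Finite.of_equiv _ e.toEquiv.symm
  exact ⟨⟨hS, i, Λ₁, ⟨(e.induceImage S).trans e₁⟩, Polytope.Class.mem_of_mul_mem hM hmem⟩,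
    contraction_connected hΓ hS hne, j, Λ₂, ⟨f.trans e₂⟩,
    Polytope.Class.mem_of_mul_mem hM (mul_comm _ (Λ₂.associahedron.toClass) ▸ hmem)⟩

theorem AssociahedronMem.induce
    (hM : ∀ X ∈ M, ∀ Y, Polytope.Class.IsFacet Y X → Y ∈ M) (h : AssociahedronMem M V Γ)
    {S : Set V} (hS : (Γ.induce S).Connected) : AssociahedronMem M S (Γ.induce S) := by
  by_cases hne : S = Set.univ
  · subst hne
    obtain ⟨-, k, Λ, ⟨e⟩, hΛM⟩ := h
    exact ⟨hS, k, Λ, ⟨(induceUnivIso Γ).trans e⟩, hΛM⟩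
  · exact (h.induce_and_contraction hM hS hne).1

end Family

end SimpleGraph

/-! ### Counting connected sets of vertices -/

namespace SimpleGraph

variable {k : ℕ} {Λ : SimpleGraph (Fin (k + 1))}

/-- The number of facets of a graph-associahedron is at least the number of singletons and edges. -/
theorem le_numFacets_associahedron (hk : 2 ≤ k) (hΛ : Λ.Connected) :
    2 * k + 1 ≤ Λ.associahedron.toClass.numFacets := by
  classical
  rw [numFacets_associahedron hΛ]
  have hedge := hΛ.card_vert_le_card_edgeSet_add_one
  rw [Nat.card_fin] at hedge
  let g : Fin (k + 1) ⊕ Λ.edgeSet → Set (Fin (k + 1)) :=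
    Sum.elim (fun v => {v}) fun e => {x | x ∈ e.1}
  have hcard : ∀ e : Λ.edgeSet, ({x | x ∈ e.1} : Set (Fin (k + 1))).ncard = 2 ∧
      (Λ.induce {x | x ∈ e.1}).Connected := by
    rintro ⟨e, he⟩
    induction e using Sym2.ind with
    | _ a b =>
      have hab : Λ.Adj a b := he
      have hset : ({x | x ∈ s(a, b)} : Set (Fin (k + 1))) = {a, b} := by
        ext x
        simp
      change ({x | x ∈ s(a, b)} : Set (Fin (k + 1))).ncard = 2 ∧
        (Λ.induce {x | x ∈ s(a, b)}).Connected
      rw [hset]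
      exact ⟨Set.ncard_pair hab.ne, induce_pair_connected hab⟩
  have hg : Function.Injective g := by
    rintro (v | e) (w | f) h
    · exact congrArg _ (Set.singleton_injective h)
    · have h1 := (hcard f).1
      rw [← show {v} = {x | x ∈ f.1} from h, Set.ncard_singleton] at h1
      omega
    · have h1 := (hcard e).1
      rw [show {x | x ∈ e.1} = {w} from h, Set.ncard_singleton] at h1
      omega
    · exact congrArg _ (Subtype.ext (Sym2.ext fun x => Set.ext_iff.mp h x))
  have hsub : Set.range g ⊆ {S | (Λ.induce S).Connected ∧ S ≠ Set.univ} := by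
    have hne : ∀ S : Set (Fin (k + 1)), S.ncard ≤ 2 → S ≠ Set.univ := by
      rintro S hS rfl
      rw [Set.ncard_univ, Nat.card_fin] at hS
      omega
    rintro _ ⟨v | e, rfl⟩
    · exact ⟨induce_singleton_connected v, hne _ ((Set.ncard_singleton v).trans_le one_le_two)⟩
    · exact ⟨(hcard e).2, hne _ (hcard e).1.le⟩
  have := Set.ncard_le_ncard hsub
  rw [← Nat.card_coe_set_eq (Set.range g), Nat.card_range_of_injective hg, Nat.card_sum,
    Nat.card_fin] at this
  omega

theorem ncard_nonempty_ne_univ (n : ℕ) :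
    {S : Set (Fin n) | S.Nonempty ∧ S ≠ Set.univ}.ncard =
      (Finset.univ.filter fun F : Finset (Fin n) => F.Nonempty ∧ F ≠ Finset.univ).card := by
  have : {S : Set (Fin n) | S.Nonempty ∧ S ≠ Set.univ} =
      (fun F : Finset (Fin n) => (F : Set (Fin n))) ''
        (Finset.univ.filter fun F : Finset (Fin n) => F.Nonempty ∧ F ≠ Finset.univ : Finset _) := by
    ext S
    obtain ⟨F, rfl⟩ : ∃ F : Finset (Fin n), S = F :=
      ⟨S.toFinite.toFinset, (Set.Finite.coe_toFinset _).symm⟩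
    simp
  rw [this, Set.ncard_image_of_injective _ Finset.coe_injective, Set.ncard_coe_finset]

theorem ncard_nonempty_ne_univ_two :
    {S : Set (Fin 2) | S.Nonempty ∧ S ≠ Set.univ}.ncard = 2 :=
  (ncard_nonempty_ne_univ 2).trans (by decide)

theorem ncard_nonempty_ne_univ_three :
    {S : Set (Fin 3) | S.Nonempty ∧ S ≠ Set.univ}.ncard = 6 :=
  (ncard_nonempty_ne_univ 3).trans (by decide)

theorem numFacets_associahedron_one {Λ : SimpleGraph (Fin 1)} (hΛ : Λ.Connected) :
    Λ.associahedron.toClass.numFacets = 0 := by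
  have : Subsingleton (Fin (0 + 1)) := inferInstanceAs (Subsingleton (Fin 1))
  rw [numFacets_associahedron hΛ, Set.ncard_eq_zero, Set.eq_empty_iff_forall_notMem]
  exact fun S hS => hS.2 (Subsingleton.eq_univ_of_nonempty (induce_connected_iff.mp hS.1).1)

theorem associahedron_one {Λ : SimpleGraph (Fin 1)} (hΛ : Λ.Connected) :
    Λ.associahedron.toClass = 1 := by
  have : Subsingleton (Fin (0 + 1)) := inferInstanceAs (Subsingleton (Fin 1))
  refine (Polytope.Class.eq_one_or_exists_isFacet _).resolve_right ?_
  rintro ⟨Y, hY⟩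
  obtain ⟨F, hF, -⟩ := Polytope.Class.isFacet_toClass.mp hY
  obtain ⟨S, hS, hne, -⟩ := exists_eq_tubeFace hΛ hF
  exact hne (Subsingleton.eq_univ_of_nonempty (induce_connected_iff.mp hS).1)

/-- The graph-associahedron with two vertices is a segment. -/
theorem numFacets_associahedron_two {Λ : SimpleGraph (Fin 2)} (hΛ : Λ.Connected) :
    Λ.associahedron.toClass.numFacets = 2 := by
  rw [numFacets_associahedron hΛ, ← ncard_nonempty_ne_univ_two]
  congr 1
  ext S
  refine and_congr_left fun hne => ⟨fun h => (induce_connected_iff.mp h).1, ?_⟩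
  rintro ⟨v, hv⟩
  obtain ⟨w, hw⟩ := (Set.ne_univ_iff_exists_notMem S).mp hne
  have : S = {v} := by
    ext x
    refine ⟨fun hx => ?_, fun hx => hx ▸ hv⟩
    have h1 : x ≠ w := fun h => hw (h ▸ hx)
    have h2 : v ≠ w := fun h => hw (h ▸ hv)
    rw [Set.mem_singleton_iff]
    omega
  rw [this]
  exact induce_singleton_connected v

/-- The associahedron of the triangle is a hexagon. -/
theorem numFacets_associahedron_top_three :
    (⊤ : SimpleGraph (Fin 3)).associahedron.toClass.numFacets = 6 := by
  rw [numFacets_associahedron connected_top, ← ncard_nonempty_ne_univ_three]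
  congr 1
  ext S
  refine and_congr_left fun _ => ⟨fun h => (induce_connected_iff.mp h).1, ?_⟩
  rintro ⟨v, hv⟩
  refine induce_connected_iff.mpr ⟨⟨v, hv⟩, fun A ⟨x, hxA, hxS⟩ hA y hy => ?_⟩
  by_cases hxy : x = y
  · exact hxy ▸ hxA
  · exact hA x hxA hxS y hy hxy

/-- The associahedron of a path with three vertices is a pentagon. -/
theorem numFacets_associahedron_three {Λ : SimpleGraph (Fin 3)} (hΛ : Λ.Connected) (hne : Λ ≠ ⊤) :
    Λ.associahedron.toClass.numFacets = 5 := by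
  refine le_antisymm ?_ (le_numFacets_associahedron le_rfl hΛ)
  obtain ⟨a, c, hac, hadj⟩ := ne_top_iff_exists_not_adj.mp hne
  have hpair : ({a, c} : Set (Fin 3)) ∈ {S : Set (Fin 3) | S.Nonempty ∧ S ≠ Set.univ} := by
    refine ⟨⟨a, .inl rfl⟩, fun h => ?_⟩
    have := congrArg Set.ncard h
    rw [Set.ncard_pair hac, Set.ncard_univ, Nat.card_fin] at this
    omega
  have hsub : {S | (Λ.induce S).Connected ∧ S ≠ Set.univ} ⊆
      {S : Set (Fin 3) | S.Nonempty ∧ S ≠ Set.univ} \ {{a, c}} := by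
    rintro S ⟨hS, hSne⟩
    refine ⟨⟨(induce_connected_iff.mp hS).1, hSne⟩, ?_⟩
    rintro rfl
    refine hac ((induce_connected_iff.mp hS).2 {a} ⟨a, rfl, .inl rfl⟩ ?_ (.inr rfl)).symm
    rintro _ rfl _ y (rfl | rfl) hy
    · rfl
    · exact (hadj hy).elim
  have := Set.ncard_le_ncard hsub
  rw [Set.ncard_sdiff_singleton_of_mem hpair, ncard_nonempty_ne_univ_three] at this
  rw [numFacets_associahedron hΛ]
  exact this

end SimpleGraph

/-! ### Products with few facets -/

namespace Polytope.Class

theorem numFacets_pow (X : Class) (n : ℕ) : numFacets (X ^ n) = n * numFacets X := by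
  induction n with
  | zero => rw [pow_zero, numFacets_one, zero_mul]
  | succ n ih => rw [pow_succ, numFacets_mul, ih, Nat.succ_mul]

end Polytope.Class

namespace SimpleGraph

open Polytope.Class

variable {Γ : ∀ k : ℕ, SimpleGraph (Fin (k + 1))}

/-- A product of graph-associahedra of a family with at most six facets is a product of segments and
of the polygon of the family. -/
theorem exists_eq_pow_mul_pow (hΓ : ∀ k, (Γ k).Connected) {X : Polytope.Class}
    (hX : X ∈ Submonoid.closure (Set.range fun k => (Γ k).associahedron.toClass)) :
    7 ≤ numFacets X ∨
      ∃ a b, X = (Γ 1).associahedron.toClass ^ a * (Γ 2).associahedron.toClass ^ b := by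
  induction hX using Submonoid.closure_induction with
  | mem X hX =>
    obtain ⟨k, rfl⟩ := hX
    match k with
    | 0 => exact .inr ⟨0, 0, by simpa using associahedron_one (hΓ 0)⟩
    | 1 => exact .inr ⟨1, 0, by simp⟩
    | 2 => exact .inr ⟨0, 1, by simp⟩
    | k + 3 =>
      have := le_numFacets_associahedron (by omega) (hΓ (k + 3))
      exact .inl (by simp only; omega)
  | one => exact .inr ⟨0, 0, by simp⟩
  | mul X Y _ _ hX hY =>
    rw [numFacets_mul]
    rcases hX with hX | ⟨a, b, rfl⟩
    · exact .inl (by omega)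
    rcases hY with hY | ⟨a', b', rfl⟩
    · exact .inl (by omega)
    · exact .inr ⟨a + a', b + b', by rw [pow_add, pow_add, mul_mul_mul_comm]⟩

theorem numFacets_of_isFacet_segment {Λ : SimpleGraph (Fin 2)} (hΛ : Λ.Connected)
    {Y : Polytope.Class} (hY : IsFacet Y Λ.associahedron.toClass) : numFacets Y = 0 := by
  obtain ⟨F, hF, rfl⟩ := isFacet_toClass.mp hY
  obtain ⟨S, hS, hne, rfl⟩ := exists_eq_tubeFace hΛ hF
  obtain ⟨i, j, Λ₁, Λ₂, ⟨e₁⟩, ⟨e₂⟩, h⟩ := exists_toClass_tubeFace_eq_mul hΛ hS hne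
  have h1 := card_coe_lt hne
  have h2 := card_notMem_lt (induce_connected_iff.mp hS).1
  rw [Nat.card_congr e₁.toEquiv, Nat.card_fin, Nat.card_fin] at h1
  rw [Nat.card_congr e₂.toEquiv, Nat.card_fin, Nat.card_fin] at h2
  obtain rfl : i = 0 := by omega
  obtain rfl : j = 0 := by omega
  rw [h, numFacets_mul, numFacets_associahedron_one (e₁.connected_iff.mp hS),
    numFacets_associahedron_one (e₂.connected_iff.mp (contraction_connected hΛ hS hne))]

/-- The hexagon is not a cube: its facets have two facets, those of a cube have four. -/
theorem associahedron_top_three_ne_pow {Λ : SimpleGraph (Fin 2)} (hΛ : Λ.Connected) :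
    (⊤ : SimpleGraph (Fin 3)).associahedron.toClass ≠ Λ.associahedron.toClass ^ 3 := by
  intro heq
  have hT : (⊤ : SimpleGraph (Fin 3)).Connected := connected_top
  have hS := induce_singleton_connected (Γ := (⊤ : SimpleGraph (Fin 3))) 0
  have hne : ({0} : Set (Fin 3)) ≠ Set.univ := fun h => by
    have : (1 : Fin 3) ∈ ({0} : Set (Fin 3)) := h.symm.subset trivial
    simp at this
  obtain ⟨i, j, Λ₁, Λ₂, ⟨e₁⟩, ⟨e₂⟩, h⟩ := exists_toClass_tubeFace_eq_mul hT hS hne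
  have h1 : Nat.card ({0} : Set (Fin 3)) = 0 + 1 := by simp
  obtain rfl := e₁.eq_of_card h1
  have h2 : Nat.card {v // v ∉ ({0} : Set (Fin 3))} = 1 + 1 := by
    rw [Nat.card_eq_fintype_card]
    decide
  obtain rfl := e₂.eq_of_card h2
  have hfac : IsFacet (Λ₁.associahedron.toClass * Λ₂.associahedron.toClass)
      (Λ.associahedron.toClass ^ 3) :=
    heq ▸ isFacet_toClass.mpr ⟨_, isCoatom_tubeFace hT hS hne, h⟩
  have hnum : numFacets (Λ₁.associahedron.toClass * Λ₂.associahedron.toClass) = 2 := by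
    rw [numFacets_mul, numFacets_associahedron_one (e₁.connected_iff.mp hS),
      numFacets_associahedron_two (e₂.connected_iff.mp (contraction_connected hT hS hne))]
  have hseg := numFacets_associahedron_two hΛ
  rw [pow_succ, pow_two] at hfac
  rcases isFacet_mul_iff.mp hfac with ⟨Y, hY, hYe⟩ | ⟨Y, hY, hYe⟩
  · rcases isFacet_mul_iff.mp hY with ⟨Z, hZ, rfl⟩ | ⟨Z, hZ, rfl⟩ <;>
    · have := numFacets_of_isFacet_segment hΛ hZ
      rw [hYe] at hnum
      simp only [numFacets_mul] at hnum
      omega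
  · have := numFacets_of_isFacet_segment hΛ hY
    rw [hYe] at hnum
    simp only [numFacets_mul] at hnum
    omega

/-- If the monoid generated by the graph-associahedra of a family is closed under passing to facets,
then the graphs are all paths or all complete. -/
theorem paths_or_complete_of_isFacet_mem (hΓ : ∀ k, (Γ k).Connected)
    (hM : ∀ X ∈ Submonoid.closure (Set.range fun k => (Γ k).associahedron.toClass),
      ∀ Y, IsFacet Y X → Y ∈ Submonoid.closure (Set.range fun k => (Γ k).associahedron.toClass)) :
    (∀ k, Nonempty (Γ k ≃g pathGraph (k + 1))) ∨ ∀ k, Γ k = ⊤ := by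
  refine paths_or_complete (AssociahedronMem (Submonoid.closure
    (Set.range fun k => (Γ k).associahedron.toClass) : Submonoid Polytope.Class))
    (fun V Λ h => h.1) (fun V Λ h S hS => h.induce hM hS)
    (fun V Λ h S hS hne => (h.induce_and_contraction hM hS hne).2) ?_ Γ
    fun k => ⟨hΓ k, k, Γ k, ⟨Iso.refl⟩, Submonoid.subset_closure ⟨k, rfl⟩⟩
  have hseg := numFacets_associahedron_two (hΓ 1)
  by_cases h2 : Γ 2 = ⊤
  · -- the polygon of the family is a hexagon; five is not of the form `2 * a + 6 * b`
    right
    rintro V Λ ⟨hΛ, k, Λ', ⟨e⟩, hmem⟩ hcard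
    obtain rfl := e.eq_of_card hcard
    rw [e.eq_top_iff]
    by_contra hne
    have h5 := numFacets_associahedron_three (e.connected_iff.mp hΛ) hne
    rcases exists_eq_pow_mul_pow hΓ hmem with h | ⟨a, b, h⟩
    · omega
    · rw [h, numFacets_mul, numFacets_pow, numFacets_pow, hseg, h2,
        numFacets_associahedron_top_three] at h5
      omega
  · -- the polygon of the family is a pentagon; six is `2 * a + 5 * b` only for `a = 3`, `b = 0`
    left
    rintro V Λ ⟨hΛ, k, Λ', ⟨e⟩, hmem⟩ hcard
    obtain rfl := e.eq_of_card hcard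
    rw [ne_eq, e.eq_top_iff]
    rintro rfl
    have h6 := numFacets_associahedron_top_three
    rcases exists_eq_pow_mul_pow hΓ hmem with h | ⟨a, b, h⟩
    · omega
    · rw [h, numFacets_mul, numFacets_pow, numFacets_pow, hseg,
        numFacets_associahedron_three (hΓ 2) h2] at h6
      obtain rfl : b = 0 := by omega
      obtain rfl : a = 3 := by omega
      rw [pow_zero, mul_one] at h
      exact associahedron_top_three_ne_pow (hΓ 1) h

end SimpleGraph

theorem theorem2p3 (Γ : ∀ k : ℕ, SimpleGraph (Fin (k + 1))) (hΓ : ∀ k, (Γ k).Connected) :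
    -- closed under `d` iff all are associahedra or all are permutohedra
    ((∀ x ∈ Subring.closure (Set.range fun k => (Γ k).associahedron.toRing),
        Polytope.d x ∈ Subring.closure (Set.range fun k => (Γ k).associahedron.toRing)) ↔
      (∀ k, (Γ k).associahedron.toRing = (SimpleGraph.pathGraph (k + 1)).associahedron.toRing) ∨
      (∀ k, (Γ k).associahedron.toRing =
        (⊤ : SimpleGraph (Fin (k + 1))).associahedron.toRing)) ∧
    -- and then the graphs themselves are all paths or all complete
    ((∀ x ∈ Subring.closure (Set.range fun k => (Γ k).associahedron.toRing),
        Polytope.d x ∈ Subring.closure (Set.range fun k => (Γ k).associahedron.toRing)) →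
      (∀ k, Nonempty (Γ k ≃g SimpleGraph.pathGraph (k + 1))) ∨ (∀ k, Γ k = ⊤)) ∧
    -- the graph lemma
    ((∀ (k : ℕ) (S : Set (Fin (k + 1))), ((Γ k).induce S).Connected → S ≠ Set.univ →
        (∃ j < k, Nonempty ((Γ k).induce S ≃g Γ j)) ∧
        (∃ j < k, Nonempty ((Γ k).contraction S ≃g Γ j))) →
      (∀ k, Nonempty (Γ k ≃g SimpleGraph.pathGraph (k + 1))) ∨ (∀ k, Γ k = ⊤)) := by
  have hrange : ∀ Λ : ∀ k : ℕ, SimpleGraph (Fin (k + 1)),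
      (Set.range fun k => (Λ k).associahedron.toRing) =
        FreeAbelianGroup.of '' Set.range fun k => (Λ k).associahedron.toClass :=
    fun Λ => Set.range_comp _ _
  have hgraphs : (∀ x ∈ Subring.closure (Set.range fun k => (Γ k).associahedron.toRing),
      Polytope.d x ∈ Subring.closure (Set.range fun k => (Γ k).associahedron.toRing)) →
      (∀ k, Nonempty (Γ k ≃g SimpleGraph.pathGraph (k + 1))) ∨ (∀ k, Γ k = ⊤) := by
    intro h
    rw [hrange, Polytope.subring_closed_iff] at h
    exact SimpleGraph.paths_or_complete_of_isFacet_mem hΓ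
      fun X hX Y hY => Polytope.Class.isFacet_mem_closure h hX hY
  refine ⟨⟨fun h => ?_, fun h => ?_⟩, hgraphs, fun h => ?_⟩
  · refine (hgraphs h).imp (fun h k => ?_) fun h k => by rw [h k]
    obtain ⟨e⟩ := h k
    exact congrArg FreeAbelianGroup.of (e.toClass_associahedron (hΓ k))
  · rcases h with h | h
    · rw [funext h, hrange fun k => SimpleGraph.pathGraph (k + 1), Polytope.subring_closed_iff]
      refine SimpleGraph.isFacet_mem_of_family (fun k => SimpleGraph.pathGraph_connected k)
        fun k S hS hne => ?_
      exact ⟨SimpleGraph.exists_induce_pathGraph_iso hS,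
        SimpleGraph.exists_contraction_pathGraph_iso hne⟩
    · rw [funext h, hrange fun k => ⊤, Polytope.subring_closed_iff]
      refine SimpleGraph.isFacet_mem_of_family (fun k => SimpleGraph.connected_top)
        fun k S hS hne => ?_
      have h1 := hS.nonempty
      have h2 := (SimpleGraph.contraction_connected SimpleGraph.connected_top hS hne).nonempty
      rw [SimpleGraph.contraction_top, SimpleGraph.induce_top]
      exact ⟨SimpleGraph.exists_iso_top, SimpleGraph.exists_iso_top⟩
  · refine SimpleGraph.paths_or_complete (fun V Λ => ∃ k, Nonempty (Λ ≃g Γ k)) ?_ ?_ ?_ ?_ Γ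
      fun k => ⟨k, ⟨SimpleGraph.Iso.refl⟩⟩
    · rintro V Λ ⟨k, ⟨e⟩⟩
      exact e.connected_iff.mpr (hΓ k)
    · rintro V Λ ⟨k, ⟨e⟩⟩ S hS
      by_cases hne : S = Set.univ
      · subst hne
        exact ⟨k, ⟨(SimpleGraph.induceUnivIso Λ).trans e⟩⟩
      · obtain ⟨⟨j, -, ⟨f⟩⟩, -⟩ := h k (e '' S) (e.induce_image_connected_iff.mpr hS)
          (e.image_ne_univ hne)
        exact ⟨j, ⟨(e.induceImage S).trans f⟩⟩
    · rintro V Λ ⟨k, ⟨e⟩⟩ S hS hne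
      obtain ⟨-, j, -, ⟨f⟩⟩ := h k (e '' S) (e.induce_image_connected_iff.mpr hS)
        (e.image_ne_univ hne)
      obtain ⟨g⟩ := e.nonempty_contraction_iso hS
      exact ⟨j, ⟨g.trans f⟩⟩
    · by_cases h2 : Γ 2 = ⊤
      · right
        rintro V Λ ⟨k, ⟨e⟩⟩ hcard
        obtain rfl := e.eq_of_card hcard
        exact e.eq_top_iff.mpr h2
      · left
        rintro V Λ ⟨k, ⟨e⟩⟩ hcard
        obtain rfl := e.eq_of_card hcard
        exact fun h => h2 (e.eq_top_iff.mp h)
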